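/- Let $k\ge 2$, let $b,c,f\in C^\infty[0,1]$ with $b>1$ on $[0,1]$, and for $0<\varepsilon<\varepsilon_0\le 1$ let $u\in C^2[0,1]$ solve $$-\varepsilon u''-bu'+cu=f\ \text{ in }(0,1),\qquad u'(0)=0,\quad u(1)=0.$$ Put $|v|_0=\|v\|_{L^2(0,1)}$, $|v|_1=|v'|_0$, $\|v\|_\varepsilon=\varepsilon^{1/2}|v|_1+|v|_0$ and $V=\{v\in H^1(0,1):v(1)=0\}$. Assume that the bilinear form $a(w,v)=\int_0^1(\varepsilon w'v'-bw'v+cwv)\,dx$ is $V$-elliptic uniformly in $\varepsilon$: for some $\gamma>0$, $a(v,v)\ge\gamma\|v\|_\varepsilon^2$ for all $v\in V$ and all $\varepsilon\in(0,\varepsilon_0)$. Let $\tau=\varepsilon^{(k-1)/k}$ and $h=\alpha H\varepsilon^{(k-1)/k}$ with $H>0$, $0<\alpha\le\alpha_1$, and consider a mesh of $[0,1]$ that is uniform with step $h$ on $[0,\tau]$ and uniform with step $H$ on $[\tau,1]$ (so $\tau/h$ and $(1-\tau)/H$ are integers). Let $V_h\subset V$ be the space of continuous functions vanishing at $1$ that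 are polynomials of degree at most $k$ on each mesh interval, and let $u_h\in V_h$ satisfy $a(u_h,v)=\int_0^1 fv\,dx$ for all $v\in V_h$. Then for every $\mu$ there is a constant $C$, depending only on $k,b,c,f,\varepsilon_0,\gamma,\alpha_1,\mu$ (in particular not on $\varepsilon$, $\alpha$, $H$ or the mesh), such that $$\|u-u_h\|_\varepsilon\le C H^k$$ whenever the layer, whose size at $x$ is $\varepsilon e^{-x/\varepsilon}$, is small at the transition point in the sense that $\varepsilon e^{-\tau/\varepsilon}\le\mu H^{k+1}$. For $k=2$ this smallness condition holds if and only if $\varepsilon\le\mu H^3$ or $\varepsilon e^{-1/\varepsilon^{1/2}}\le\mu H^3$. -/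

import Mathlib

open Set MeasureTheory
open scoped ContDiff Polynomial

namespace WeakLayer

/-- The Sobolev space `H¹(0,1)`: in one dimension these are the absolutely continuous functions on
`[0,1]` whose (almost everywhere existing, equivalently weak) derivative is square integrable. -/
def MemH1 (v : ℝ → ℝ) : Prop :=
  AbsolutelyContinuousOnInterval v 0 1 ∧ MemLp (deriv v) 2 (volume.restrict (Ioc (0 : ℝ) 1))

/-- The energy space `V = {v ∈ H¹(0,1) : v(1) = 0}`. -/
def MemV (v : ℝ → ℝ) : Prop :=
  MemH1 v ∧ v 1 = 0

/-- `|v|₀`, the norm of `L²(0,1)`. -/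
noncomputable def norm0 (v : ℝ → ℝ) : ℝ :=
  Real.sqrt (∫ x in (0 : ℝ)..1, (v x) ^ 2)

/-- `|v|₁`, the seminorm of `H¹(0,1)`. -/
noncomputable def semi1 (v : ℝ → ℝ) : ℝ :=
  Real.sqrt (∫ x in (0 : ℝ)..1, (deriv v x) ^ 2)

/-- `‖v‖_ε = ε^{1/2} |v|₁ + |v|₀`. -/
noncomputable def epsNorm (ε : ℝ) (v : ℝ → ℝ) : ℝ :=
  Real.sqrt ε * semi1 v + norm0 v

/-- The bilinear form `a(w,v) = ε (w',v') - (b w',v) + (c w,v)` of the problem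
`-ε u'' - b u' + c u = f`, `u'(0) = 0`, `u(1) = 0`. -/
noncomputable def bilin (ε : ℝ) (b c : ℝ → ℝ) (w v : ℝ → ℝ) : ℝ :=
  ∫ x in (0 : ℝ)..1, (ε * deriv w x * deriv v x - b x * deriv w x * v x + c x * w x * v x)

/-- `V`-ellipticity of the bilinear form with respect to `‖·‖_ε`, with constant `γ`. -/
def VElliptic (ε : ℝ) (b c : ℝ → ℝ) (γ : ℝ) : Prop :=
  ∀ v : ℝ → ℝ, MemV v → γ * epsNorm ε v ^ 2 ≤ bilin ε b c v v

/-- Classical solutions, twice continuously differentiable up to the boundary, of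
`-ε u'' - b u' + c u = f` in `(0,1)`, `u'(0) = 0`, `u(1) = 0`. -/
structure IsSolution (ε : ℝ) (b c f u : ℝ → ℝ) : Prop where
  contDiffOn : ContDiffOn ℝ 2 u (Icc 0 1)
  equation : ∀ x ∈ Ioo (0 : ℝ) 1, -ε * deriv (deriv u) x - b x * deriv u x + c x * u x = f x
  left_bc : derivWithin u (Icc 0 1) 0 = 0
  right_bc : u 1 = 0

/-- The transition point `τ = ε^{(k-1)/k}`. -/
noncomputable def transition (k : ℕ) (ε : ℝ) : ℝ :=
  ε ^ (((k : ℝ) - 1) / (k : ℝ))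

/-- The fine step `h = α H ε^{(k-1)/k}`. -/
noncomputable def fineStep (k : ℕ) (ε α H : ℝ) : ℝ :=
  α * H * ε ^ (((k : ℝ) - 1) / (k : ℝ))

/-- `H` and `α` are admissible mesh parameters: `N₁` steps of size `h` fill `[0,τ]` and `N₂` steps
of size `H` fill `[τ,1]`. -/
structure IsMesh (k : ℕ) (ε α H : ℝ) (N₁ N₂ : ℕ) : Prop where
  H_pos : 0 < H
  α_pos : 0 < α
  fine : (N₁ : ℝ) * fineStep k ε α H = transition k ε
  coarse : (N₂ : ℝ) * H = 1 - transition k ε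

/-- The mesh points `x_i`, `0 ≤ i ≤ N₁ + N₂`: step `h` on `[0,τ]`, step `H` on `[τ,1]`. -/
noncomputable def node (k : ℕ) (ε α H : ℝ) (N₁ : ℕ) (i : ℕ) : ℝ :=
  if i ≤ N₁ then (i : ℝ) * fineStep k ε α H
  else transition k ε + ((i : ℝ) - (N₁ : ℝ)) * H

/-- The finite element space `V_h ⊆ V`: continuous functions on `[0,1]` that vanish at `1` and are
polynomials of degree at most `k` on every mesh interval. -/
structure MemFE (k : ℕ) (ε α H : ℝ) (N₁ N₂ : ℕ) (v : ℝ → ℝ) : Prop where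
  continuousOn : ContinuousOn v (Icc 0 1)
  right_bc : v 1 = 0
  piecewise : ∀ i < N₁ + N₂, ∃ p : ℝ[X], p.natDegree ≤ k ∧
    ∀ x ∈ Icc (node k ε α H N₁ i) (node k ε α H N₁ (i + 1)), v x = p.eval x

/-- `u_h ∈ V_h` is the finite element solution: `a(u_h,v) = (f,v)` for all `v ∈ V_h`. -/
def IsFESolution (k : ℕ) (ε α H : ℝ) (N₁ N₂ : ℕ) (b c f uh : ℝ → ℝ) : Prop :=
  MemFE k ε α H N₁ N₂ uh ∧
    ∀ v : ℝ → ℝ, MemFE k ε α H N₁ N₂ v → bilin ε b c uh v = ∫ x in (0 : ℝ)..1, f x * v x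

/-- The layer is small at the transition point: the size `ε e^{-x/ε}` of the weak layer satisfies
`ε e^{-τ/ε} ≤ μ H^{k+1}` at `x = τ`. -/
def LayerSmall (k : ℕ) (ε H μ : ℝ) : Prop :=
  ε * Real.exp (-(transition k ε / ε)) ≤ μ * H ^ (k + 1)

end WeakLayer

/-! The form is coercive in the `ε`-norm, and its convective part also controls the value at the
outflow end: `e(0)^2 ≤ 2 a(e,e) + 3B |e|₀^2` (`sq_left_le`). By Galerkin orthogonality it therefore
suffices (`error_le_of_approx`) to find `v ∈ V_h` within `O(H^k)` of `u` in the `ε`-norm such that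
`|a(u-v,e)| ≤ δ (‖e‖_ε + |e(0)|)` for all `e ∈ V_h`, with `δ = O(H^k)`. Two regimes supply such a
`v`.

If `ε ≤ H^k`, the layer can be ignored (`exists_error_small`). The solution `S` of the reduced
problem `-bS' + cS = f`, `S(1) = 0`, is smooth and independent of `ε`, and `a(u-S,e) = ε (S'(0) e(0)
+ ∫ S'' e)`. Hence `u - S` is `O(ε)`, both in norm and in consistency; the term `S'(0) e(0)` is the
reason for carrying `|e(0)|` along. The piecewise polynomial approximation of `S` and of `S'` is of
order `H^k`. Smallness of the layer at the transition point plays no role.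

If `H^k ≤ ε`, then `τ^k = ε^(k-1)` gives `Hτ ≤ ε`, so `h = O(ε)` and the fine mesh resolves the
layer (`exists_error_large`). The approximation rests on `|u^(j)| ≤ C (1 + ε^(1-j) e^(-x/ε))`
(`exists_layer_bound`) and on a local interpolant (`exists_quasiInterp`) that matches nodal values.
As `v(0) = u(0)` and `e(1) = 0`, the convective term can be integrated by parts without boundary
terms, which leads to `∫ (u-v) b e'`. On `[0,τ]` the `L²` error is `O(√ε H^k)`, and its `√ε` is
paired with `|e|₁`. On `[τ,1]` the smallness of the layer makes the error `O(H^(k+1))`, and the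
additional `H` pays for an inverse inequality. -/

namespace WeakLayer

/-! ### Lipschitz and bounded measurable functions on the unit interval -/

/-- Lipschitz continuity on the unit interval. -/
def LipI (v : ℝ → ℝ) : Prop := ∃ K : NNReal, LipschitzOnWith K v (Icc 0 1)

/-- Bounded measurable functions on the unit interval. -/
def BM (g : ℝ → ℝ) : Prop :=
  AEStronglyMeasurable g (volume.restrict (Ioc (0 : ℝ) 1)) ∧ ∃ K, ∀ x ∈ Ioo (0 : ℝ) 1, |g x| ≤ K

lemma ae_restrict_Ioc_of_ae_Ioo {P : ℝ → Prop} {a b : ℝ} (h : ∀ᵐ x : ℝ, x ∈ Ioo a b → P x) :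
    ∀ᵐ x ∂(volume.restrict (Ioc a b)), P x := by
  rw [← restrict_Ioo_eq_restrict_Ioc]
  exact (ae_restrict_iff' measurableSet_Ioo).2 h

lemma ae_of_forall_Ioo {P : ℝ → Prop} {a b : ℝ} (h : ∀ x ∈ Ioo a b, P x) :
    ∀ᵐ x : ℝ, x ∈ Ioo a b → P x := Filter.Eventually.of_forall h

lemma integral_le_of_ae_Ioo {f g : ℝ → ℝ} {a b : ℝ} (hab : a ≤ b)
    (hf : IntervalIntegrable f volume a b) (hg : IntervalIntegrable g volume a b)
    (h : ∀ᵐ x : ℝ, x ∈ Ioo a b → f x ≤ g x) : ∫ x in a..b, f x ≤ ∫ x in a..b, g x := by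
  refine intervalIntegral.integral_mono_ae_restrict hab hf hg ?_
  rw [← restrict_Ioo_eq_restrict_Icc]
  exact (ae_restrict_iff' measurableSet_Ioo).2 h

lemma integral_congr_Ioo {f g : ℝ → ℝ} {a b : ℝ} (hab : a ≤ b)
    (h : ∀ᵐ x : ℝ, x ∈ Ioo a b → f x = g x) : ∫ x in a..b, f x = ∫ x in a..b, g x := by
  rw [intervalIntegral.integral_of_le hab, intervalIntegral.integral_of_le hab]
  exact integral_congr_ae (ae_restrict_Ioc_of_ae_Ioo h)

namespace BM

variable {g h : ℝ → ℝ}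

lemma mul (hg : BM g) (hh : BM h) : BM (fun x => g x * h x) := by
  obtain ⟨mg, K, hK⟩ := hg
  obtain ⟨mh, L, hL⟩ := hh
  refine ⟨mg.mul mh, K * L, fun x hx => ?_⟩
  rw [abs_mul]
  exact mul_le_mul (hK x hx) (hL x hx) (abs_nonneg _) ((abs_nonneg _).trans (hK x hx))

lemma add (hg : BM g) (hh : BM h) : BM (fun x => g x + h x) := by
  obtain ⟨mg, K, hK⟩ := hg
  obtain ⟨mh, L, hL⟩ := hh
  exact ⟨mg.add mh, K + L, fun x hx => (abs_add_le _ _).trans (add_le_add (hK x hx) (hL x hx))⟩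

lemma neg (hg : BM g) : BM (fun x => -g x) := by
  obtain ⟨mg, K, hK⟩ := hg
  exact ⟨mg.neg, K, fun x hx => by rw [abs_neg]; exact hK x hx⟩

lemma sub (hg : BM g) (hh : BM h) : BM (fun x => g x - h x) := by
  simpa [sub_eq_add_neg] using hg.add hh.neg

lemma const (r : ℝ) : BM (fun _ => r) := ⟨aestronglyMeasurable_const, |r|, fun _ _ => le_rfl⟩

lemma pow (hg : BM g) (n : ℕ) : BM (fun x => g x ^ n) := by
  obtain ⟨mg, K, hK⟩ := hg
  refine ⟨mg.pow n, K ^ n, fun x hx => ?_⟩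
  rw [abs_pow]
  exact pow_le_pow_left₀ (abs_nonneg _) (hK x hx) n

lemma of_continuousOn (hg : ContinuousOn g (Icc 0 1)) : BM g := by
  obtain ⟨K, hK⟩ := isCompact_Icc.exists_bound_of_continuousOn hg
  exact ⟨(hg.mono Ioc_subset_Icc_self).aestronglyMeasurable measurableSet_Ioc, K,
    fun x hx => hK x (Ioo_subset_Icc_self hx)⟩

lemma ii (hg : BM g) {a b : ℝ} (ha : 0 ≤ a) (hab : a ≤ b) (hb : b ≤ 1) :
    IntervalIntegrable g volume a b := by
  obtain ⟨mg, K, hK⟩ := hg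
  rw [intervalIntegrable_iff_integrableOn_Ioc_of_le hab]
  have : IntegrableOn g (Ioc 0 1) :=
    Integrable.of_bound mg K (ae_restrict_Ioc_of_ae_Ioo (ae_of_forall_Ioo hK))
  exact this.mono_set (Ioc_subset_Ioc ha hb)

lemma ii01 (hg : BM g) : IntervalIntegrable g volume 0 1 := hg.ii le_rfl zero_le_one le_rfl

end BM

namespace LipI

variable {u v : ℝ → ℝ}

lemma continuousOn (hv : LipI v) : ContinuousOn v (Icc 0 1) := hv.choose_spec.continuousOn

lemma ac (hv : LipI v) : AbsolutelyContinuousOnInterval v 0 1 := by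
  obtain ⟨K, hK⟩ := hv
  refine LipschitzOnWith.absolutelyContinuousOnInterval (K := K) ?_
  rwa [uIcc_of_le zero_le_one]

lemma deriv_bound (hv : LipI v) : ∃ K : ℝ, ∀ x ∈ Ioo (0 : ℝ) 1, |deriv v x| ≤ K := by
  obtain ⟨K, hK⟩ := hv
  exact ⟨K, fun x hx => norm_deriv_le_of_lipschitzOn (Icc_mem_nhds hx.1 hx.2) hK⟩

lemma bm (hv : LipI v) : BM v := BM.of_continuousOn hv.continuousOn

lemma bm_deriv (hv : LipI v) : BM (deriv v) :=
  ⟨(measurable_deriv v).aestronglyMeasurable, hv.deriv_bound⟩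

lemma ae_diff (hv : LipI v) : ∀ᵐ x : ℝ, x ∈ Ioo (0 : ℝ) 1 → DifferentiableAt ℝ v x := by
  filter_upwards [hv.ac.ae_differentiableAt] with x hx h
  rw [uIcc_of_le zero_le_one] at hx
  exact hx (Ioo_subset_Icc_self h)

lemma sub (hu : LipI u) (hv : LipI v) : LipI (fun x => u x - v x) := by
  obtain ⟨K, hK⟩ := hu
  obtain ⟨L, hL⟩ := hv
  exact ⟨K + L, hK.sub hL⟩

/-- Ellipticity is only applied to `u`, `u - S` and finite element functions, all of which are
Lipschitz; this places them in `H¹`. -/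
lemma memH1 (hv : LipI v) : MemH1 v := by
  obtain ⟨m, K, hK⟩ := hv.bm_deriv
  exact ⟨hv.ac, MemLp.of_bound m K (ae_restrict_Ioc_of_ae_Ioo (ae_of_forall_Ioo hK))⟩

lemma deriv_sub (hu : LipI u) (hv : LipI v) :
    ∀ᵐ x : ℝ, x ∈ Ioo (0 : ℝ) 1 → deriv (fun y => u y - v y) x = deriv u x - deriv v x := by
  filter_upwards [hu.ae_diff, hv.ae_diff] with x h1 h2 hx
  exact deriv_fun_sub (h1 hx) (h2 hx)

lemma of_hasDerivWithinAt {v' : ℝ → ℝ}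
    (h : ∀ x ∈ Icc (0 : ℝ) 1, HasDerivWithinAt v (v' x) (Icc 0 1) x)
    (h' : ContinuousOn v' (Icc 0 1)) : LipI v := by
  obtain ⟨K, hK⟩ := isCompact_Icc.exists_bound_of_continuousOn h'
  refine ⟨K.toNNReal, Convex.lipschitzOnWith_of_nnnorm_hasDerivWithin_le (convex_Icc 0 1) h ?_⟩
  intro x hx
  rw [← NNReal.coe_le_coe, coe_nnnorm]
  exact (hK x hx).trans (Real.le_coe_toNNReal K)

lemma of_contDiffOn {n : WithTop ℕ∞} (hn : 1 ≤ n) (h : ContDiffOn ℝ n v (Icc 0 1)) : LipI v :=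
  of_hasDerivWithinAt
    (fun x hx => ((h.differentiableOn (by positivity)) x hx).hasDerivWithinAt)
    (h.continuousOn_derivWithin (uniqueDiffOn_Icc zero_lt_one) hn)

/-- Integration by parts. -/
lemma integral_mul_deriv (hu : LipI u) (hv : LipI v) :
    ∫ x in (0 : ℝ)..1, u x * deriv v x =
      u 1 * v 1 - u 0 * v 0 - ∫ x in (0 : ℝ)..1, deriv u x * v x :=
  hu.ac.integral_mul_deriv_eq_deriv_mul hv.ac

lemma mul (hu : LipI u) (hv : LipI v) : LipI (fun x => u x * v x) := by
  obtain ⟨A, hA⟩ := isCompact_Icc.exists_bound_of_continuousOn hu.continuousOn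
  obtain ⟨B, hB⟩ := isCompact_Icc.exists_bound_of_continuousOn hv.continuousOn
  obtain ⟨K, hK⟩ := hu
  obtain ⟨L, hL⟩ := hv
  refine ⟨(A * L + B * K).toNNReal, LipschitzOnWith.of_dist_le_mul fun x hx y hy => ?_⟩
  have h1 := hK.dist_le_mul x hx y hy
  have h2 := hL.dist_le_mul x hx y hy
  have h3 := hA x hx
  have h4 := hB y hy
  simp only [Real.dist_eq, Real.norm_eq_abs] at *
  have e : u x * v x - u y * v y = u x * (v x - v y) + v y * (u x - u y) := by ring
  calc |u x * v x - u y * v y| ≤ |u x| * |v x - v y| + |v y| * |u x - u y| := by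
        rw [e, ← abs_mul, ← abs_mul]; exact abs_add_le _ _
    _ ≤ A * (L * |x - y|) + B * (K * |x - y|) :=
        add_le_add (mul_le_mul h3 h2 (abs_nonneg _) ((abs_nonneg _).trans h3))
          (mul_le_mul h4 h1 (abs_nonneg _) ((abs_nonneg _).trans h4))
    _ = (A * L + B * K) * |x - y| := by ring
    _ ≤ _ := by gcongr; exact Real.le_coe_toNNReal _

lemma deriv_mul (hu : LipI u) (hv : LipI v) :
    ∀ᵐ x : ℝ, x ∈ Ioo (0 : ℝ) 1 →
      deriv (fun y => u y * v y) x = deriv u x * v x + u x * deriv v x := by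
  filter_upwards [hu.ae_diff, hv.ae_diff] with x h1 h2 hx
  exact deriv_fun_mul (h1 hx) (h2 hx)

end LipI

/-! ### The `L²` and energy norms -/

lemma norm0_nonneg (v : ℝ → ℝ) : 0 ≤ norm0 v := Real.sqrt_nonneg _

lemma semi1_nonneg (v : ℝ → ℝ) : 0 ≤ semi1 v := Real.sqrt_nonneg _

lemma norm0_sq (v : ℝ → ℝ) : norm0 v ^ 2 = ∫ x in (0 : ℝ)..1, v x ^ 2 :=
  Real.sq_sqrt (intervalIntegral.integral_nonneg zero_le_one fun _ _ => sq_nonneg _)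

lemma epsNorm_nonneg (ε : ℝ) (v : ℝ → ℝ) : 0 ≤ epsNorm ε v :=
  add_nonneg (mul_nonneg (Real.sqrt_nonneg _) (semi1_nonneg _)) (norm0_nonneg _)

lemma norm0_le_epsNorm (ε : ℝ) (v : ℝ → ℝ) : norm0 v ≤ epsNorm ε v :=
  le_add_of_nonneg_left (mul_nonneg (Real.sqrt_nonneg _) (semi1_nonneg _))

lemma sqrt_mul_semi1_le_epsNorm (ε : ℝ) (v : ℝ → ℝ) : Real.sqrt ε * semi1 v ≤ epsNorm ε v :=
  le_add_of_nonneg_right (norm0_nonneg _)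

/-- The Cauchy-Schwarz inequality on a subinterval. -/
lemma abs_integral_mul_le {g h : ℝ → ℝ} (hg : BM g) (hh : BM h) {a b : ℝ} (ha : 0 ≤ a)
    (hab : a ≤ b) (hb : b ≤ 1) :
    |∫ x in a..b, g x * h x| ≤
      Real.sqrt (∫ x in a..b, g x ^ 2) * Real.sqrt (∫ x in a..b, h x ^ 2) := by
  have ig := (hg.pow 2).ii ha hab hb
  have ih := (hh.pow 2).ii ha hab hb
  have igh := (hg.mul hh).ii ha hab hb
  have pos : ∀ t : ℝ, 0 ≤ (∫ x in a..b, g x ^ 2) * (t * t) + (2 * ∫ x in a..b, g x * h x) * t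
      + ∫ x in a..b, h x ^ 2 := by
    intro t
    have : (∫ x in a..b, g x ^ 2) * (t * t) + (2 * ∫ x in a..b, g x * h x) * t
        + ∫ x in a..b, h x ^ 2 = ∫ x in a..b, (t * g x + h x) ^ 2 := by
      have e : ∀ x, (t * g x + h x) ^ 2 = (t * t) * g x ^ 2 + (2 * t) * (g x * h x) + h x ^ 2 :=
        fun x => by ring
      simp_rw [e]
      rw [intervalIntegral.integral_add ((ig.const_mul _).add (igh.const_mul _)) ih,
        intervalIntegral.integral_add (ig.const_mul _) (igh.const_mul _),
        intervalIntegral.integral_const_mul, intervalIntegral.integral_const_mul]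
      ring
    rw [this]
    exact intervalIntegral.integral_nonneg hab fun _ _ => sq_nonneg _
  have d := discrim_le_zero pos
  rw [discrim] at d
  have h0 : 0 ≤ ∫ x in a..b, g x ^ 2 := intervalIntegral.integral_nonneg hab fun _ _ => sq_nonneg _
  rw [← Real.sqrt_mul h0]
  apply Real.abs_le_sqrt
  nlinarith

lemma abs_integral_mul_le_norm0 {g h : ℝ → ℝ} (hg : BM g) (hh : BM h) :
    |∫ x in (0 : ℝ)..1, g x * h x| ≤ norm0 g * norm0 h :=
  abs_integral_mul_le hg hh le_rfl zero_le_one le_rfl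

lemma sqrt_integral_sq_le {g : ℝ → ℝ} (hg : BM g) {a b K : ℝ} (ha : 0 ≤ a)
    (hab : a ≤ b) (hb : b ≤ 1) (hK : 0 ≤ K) (h : ∀ᵐ x : ℝ, x ∈ Ioo a b → |g x| ≤ K) :
    Real.sqrt (∫ x in a..b, g x ^ 2) ≤ K := by
  apply Real.sqrt_le_iff.2 ⟨hK, ?_⟩
  calc ∫ x in a..b, g x ^ 2 ≤ ∫ x in a..b, K ^ 2 := by
        refine integral_le_of_ae_Ioo hab ((hg.pow 2).ii ha hab hb) (by simp) ?_
        filter_upwards [h] with x hx hx'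
        exact sq_le_sq' (by linarith [neg_abs_le (g x), hx hx']) ((le_abs_self _).trans (hx hx'))
    _ ≤ K ^ 2 := by
        rw [intervalIntegral.integral_const, smul_eq_mul]
        nlinarith [sq_nonneg K]

lemma norm0_le {g : ℝ → ℝ} (hg : BM g) {K : ℝ} (hK : 0 ≤ K)
    (h : ∀ᵐ x : ℝ, x ∈ Ioo (0 : ℝ) 1 → |g x| ≤ K) : norm0 g ≤ K :=
  sqrt_integral_sq_le hg le_rfl zero_le_one le_rfl hK h

/-- A weighted bound: `|∫ b g h| ≤ B |g|₀ |h|₀` if `|b| ≤ B`. -/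
lemma abs_integral_mul_mul_le {b g h : ℝ → ℝ} {B : ℝ} (hb : BM b) (hg : BM g) (hh : BM h)
    (hB : ∀ x ∈ Ioo (0 : ℝ) 1, |b x| ≤ B) :
    |∫ x in (0 : ℝ)..1, b x * g x * h x| ≤ B * (norm0 g * norm0 h) := by
  have hB0 : 0 ≤ B := (abs_nonneg _).trans (hB (1 / 2) (by norm_num))
  refine (abs_integral_mul_le_norm0 (hb.mul hg) hh).trans ?_
  rw [← mul_assoc]
  gcongr
  · exact norm0_nonneg _
  rw [norm0, Real.sqrt_le_iff]
  refine ⟨mul_nonneg hB0 (norm0_nonneg _), ?_⟩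
  rw [mul_pow, norm0_sq, ← intervalIntegral.integral_const_mul]
  refine integral_le_of_ae_Ioo zero_le_one ((hb.mul hg).pow 2).ii01
    ((hg.pow 2).ii01.const_mul _) (ae_of_forall_Ioo fun x hx => ?_)
  rw [mul_pow]
  exact mul_le_mul_of_nonneg_right
    (sq_le_sq' (by linarith [neg_abs_le (b x), hB x hx]) ((le_abs_self _).trans (hB x hx)))
    (sq_nonneg _)

lemma norm0_add_le {g h k : ℝ → ℝ} (hg : BM g) (hh : BM h)
    (e : ∀ᵐ x : ℝ, x ∈ Ioo (0 : ℝ) 1 → k x = g x + h x) :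
    norm0 k ≤ norm0 g + norm0 h := by
  rw [norm0, Real.sqrt_le_iff]
  refine ⟨add_nonneg (norm0_nonneg _) (norm0_nonneg _), ?_⟩
  have h1 : ∫ x in (0 : ℝ)..1, k x ^ 2 =
      norm0 g ^ 2 + 2 * (∫ x in (0 : ℝ)..1, g x * h x) + norm0 h ^ 2 := by
    rw [norm0_sq, norm0_sq, ← intervalIntegral.integral_const_mul,
      ← intervalIntegral.integral_add (hg.pow 2).ii01 ((hg.mul hh).ii01.const_mul _),
      ← intervalIntegral.integral_add ((hg.pow 2).ii01.add ((hg.mul hh).ii01.const_mul _))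
        (hh.pow 2).ii01]
    refine integral_congr_Ioo zero_le_one ?_
    filter_upwards [e] with x hx hx'
    rw [hx hx']
    ring
  rw [h1]
  have := (le_abs_self _).trans (abs_integral_mul_le_norm0 hg hh)
  nlinarith

lemma epsNorm_le_add {ε : ℝ} {u v w : ℝ → ℝ} (hu : LipI u) (hv : LipI v)
    (e : ∀ x, w x = u x + v x) : epsNorm ε w ≤ epsNorm ε u + epsNorm ε v := by
  have h0 : norm0 w ≤ norm0 u + norm0 v :=
    norm0_add_le hu.bm hv.bm (Filter.Eventually.of_forall fun x _ => e x)
  have h1 : semi1 w ≤ semi1 u + semi1 v := by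
    refine norm0_add_le hu.bm_deriv hv.bm_deriv ?_
    filter_upwards [hu.ae_diff, hv.ae_diff] with x h1 h2 hx
    rw [show w = fun x => u x + v x from funext e]
    exact deriv_fun_add (h1 hx) (h2 hx)
  unfold epsNorm
  nlinarith [mul_le_mul_of_nonneg_left h1 (Real.sqrt_nonneg ε)]

/-! ### Sequences of successive derivatives -/

/-- Families `F 0, F 1, F 2, …` of functions on the unit interval, each the derivative of the
preceding one. -/
def DerivFam (F : ℕ → ℝ → ℝ) : Prop :=
  ∀ j, ∀ x ∈ Icc (0 : ℝ) 1, HasDerivWithinAt (F j) (F (j + 1) x) (Icc 0 1) x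

namespace DerivFam

variable {F : ℕ → ℝ → ℝ}

lemma continuousOn (hF : DerivFam F) (j : ℕ) : ContinuousOn (F j) (Icc 0 1) :=
  fun x hx => (hF j x hx).continuousWithinAt

lemma lipI (hF : DerivFam F) (j : ℕ) : LipI (F j) :=
  LipI.of_hasDerivWithinAt (hF j) (hF.continuousOn (j + 1))

lemma hasDerivAt (hF : DerivFam F) (j : ℕ) {x : ℝ} (hx : x ∈ Ioo (0 : ℝ) 1) :
    HasDerivAt (F j) (F (j + 1) x) x :=
  (hF j x (Ioo_subset_Icc_self hx)).hasDerivAt (Icc_mem_nhds hx.1 hx.2)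

lemma shift (hF : DerivFam F) (m : ℕ) : DerivFam (fun j => F (j + m)) := fun j x hx => by
  have := hF (j + m) x hx
  rwa [show j + m + 1 = j + 1 + m by ring] at this

lemma bound (hF : DerivFam F) (j : ℕ) : ∃ K, 0 < K ∧ ∀ x ∈ Icc (0 : ℝ) 1, |F j x| ≤ K := by
  obtain ⟨K, hK⟩ := isCompact_Icc.exists_bound_of_continuousOn (hF.continuousOn j)
  exact ⟨max K 1, by positivity, fun x hx => (hK x hx).trans (le_max_left _ _)⟩

lemma of_contDiffOn {v : ℝ → ℝ} (hv : ContDiffOn ℝ ∞ v (Icc 0 1)) :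
    DerivFam (fun j => iteratedDerivWithin j v (Icc 0 1)) := fun j x hx => by
  have := (hv.differentiableOn_iteratedDerivWithin (m := j) (by exact_mod_cast ENat.natCast_lt_top j)
    (uniqueDiffOn_Icc zero_lt_one)) x hx
  show HasDerivWithinAt _ (iteratedDerivWithin (j + 1) v (Icc 0 1) x) _ _
  rw [iteratedDerivWithin_succ]
  exact this.hasDerivWithinAt

end DerivFam

/-! ### The bilinear form: continuity, integration by parts, coercivity -/

/-- The data of the problem, with one constant bounding all of them. -/
structure Coef (b c : ℝ → ℝ) (B : ℝ) : Prop where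
  lip : LipI b
  cont : ContinuousOn c (Icc 0 1)
  b_le : ∀ x ∈ Icc (0 : ℝ) 1, |b x| ≤ B
  c_le : ∀ x ∈ Icc (0 : ℝ) 1, |c x| ≤ B
  b'_le : ∀ x ∈ Ioo (0 : ℝ) 1, |deriv b x| ≤ B
  one_lt : ∀ x ∈ Icc (0 : ℝ) 1, 1 < b x

lemma exists_coef {b c : ℝ → ℝ} (hb : LipI b) (hc : ContinuousOn c (Icc 0 1))
    (h1 : ∀ x ∈ Icc (0 : ℝ) 1, 1 < b x) : ∃ B, Coef b c B := by
  obtain ⟨K, hK⟩ := isCompact_Icc.exists_bound_of_continuousOn hb.continuousOn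
  obtain ⟨L, hL⟩ := isCompact_Icc.exists_bound_of_continuousOn hc
  obtain ⟨M, hM⟩ := hb.deriv_bound
  refine ⟨max K (max L M), hb, hc, fun x hx => (hK x hx).trans (le_max_left _ _),
    fun x hx => (hL x hx).trans ((le_max_left _ _).trans (le_max_right _ _)),
    fun x hx => (hM x hx).trans ((le_max_right _ _).trans (le_max_right _ _)), h1⟩

section bilin

variable {ε B γ : ℝ} {b c u v w e : ℝ → ℝ}

lemma Coef.one_le (h : Coef b c B) : 1 ≤ B := by
  have := h.one_lt 0 (by simp)
  exact this.le.trans ((le_abs_self _).trans (h.b_le 0 (by simp)))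

lemma bm_bilin (h : Coef b c B) (hu : LipI u) (hv : LipI v) :
    BM (fun x => ε * deriv u x * deriv v x - b x * deriv u x * v x + c x * u x * v x) :=
  (((((BM.const ε).mul hu.bm_deriv).mul hv.bm_deriv).sub
    ((h.lip.bm.mul hu.bm_deriv).mul hv.bm)).add
    (((BM.of_continuousOn h.cont).mul hu.bm).mul hv.bm))

lemma bilin_sub (h : Coef b c B) (hu : LipI u) (hw : LipI w) (hv : LipI v) :
    bilin ε b c (fun x => u x - w x) v = bilin ε b c u v - bilin ε b c w v := by
  unfold bilin
  rw [← intervalIntegral.integral_sub (bm_bilin h hu hv).ii01 (bm_bilin h hw hv).ii01]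
  refine integral_congr_Ioo zero_le_one ?_
  filter_upwards [hu.deriv_sub hw] with x hx hx'
  rw [hx hx']
  ring

lemma bilin_eq (h : Coef b c B) (hu : LipI u) (hv : LipI v) :
    bilin ε b c u v = ε * (∫ x in (0 : ℝ)..1, deriv u x * deriv v x)
      - (∫ x in (0 : ℝ)..1, b x * deriv u x * v x) + ∫ x in (0 : ℝ)..1, c x * u x * v x := by
  unfold bilin
  have h1 := (((BM.const ε).mul hu.bm_deriv).mul hv.bm_deriv).ii01
  have h2 := ((h.lip.bm.mul hu.bm_deriv).mul hv.bm).ii01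
  have h3 := (((BM.of_continuousOn h.cont).mul hu.bm).mul hv.bm).ii01
  rw [intervalIntegral.integral_add (h1.sub h2) h3, intervalIntegral.integral_sub h1 h2,
    ← intervalIntegral.integral_const_mul]
  simp_rw [mul_assoc]

/-- Plain Cauchy-Schwarz. It serves the regime `ε ≤ H^k`, where the interpolation error of the
reduced solution is small in `|·|₁` without a weight `√ε`. -/
lemma abs_bilin_le (hε : 0 ≤ ε) (h : Coef b c B) (hu : LipI u) (hv : LipI v) :
    |bilin ε b c u v| ≤ ε * (semi1 u * semi1 v) + B * (semi1 u * norm0 v)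
      + B * (norm0 u * norm0 v) := by
  rw [bilin_eq h hu hv]
  refine (abs_add_le _ _).trans (add_le_add ((abs_sub _ _).trans (add_le_add ?_ ?_)) ?_)
  · rw [abs_mul, abs_of_nonneg hε]
    exact mul_le_mul_of_nonneg_left (abs_integral_mul_le_norm0 hu.bm_deriv hv.bm_deriv) hε
  · exact abs_integral_mul_mul_le h.lip.bm hu.bm_deriv hv.bm
      fun x hx => h.b_le x (Ioo_subset_Icc_self hx)
  · exact abs_integral_mul_mul_le (BM.of_continuousOn h.cont) hu.bm hv.bm
      fun x hx => h.c_le x (Ioo_subset_Icc_self hx)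

lemma integral_convection (h : Coef b c B) (hu : LipI u) (hv : LipI v) (hv1 : v 1 = 0) :
    ∫ x in (0 : ℝ)..1, b x * deriv u x * v x =
      -(b 0 * u 0 * v 0) - (∫ x in (0 : ℝ)..1, deriv b x * u x * v x)
        - ∫ x in (0 : ℝ)..1, u x * (b x * deriv v x) := by
  have h1 : ∫ x in (0 : ℝ)..1, b x * deriv u x * v x =
      ∫ x in (0 : ℝ)..1, (b x * v x) * deriv u x := by
    congr 1; ext x; ring
  have h2 : ∫ x in (0 : ℝ)..1, deriv (fun y => b y * v y) x * u x =
      (∫ x in (0 : ℝ)..1, deriv b x * u x * v x) + ∫ x in (0 : ℝ)..1, u x * (b x * deriv v x) := by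
    rw [← intervalIntegral.integral_add ((h.lip.bm_deriv.mul hu.bm).mul hv.bm).ii01
      (hu.bm.mul (h.lip.bm.mul hv.bm_deriv)).ii01]
    refine integral_congr_Ioo zero_le_one ?_
    filter_upwards [h.lip.deriv_mul hv] with x hx hx'
    rw [hx hx']
    ring
  rw [h1, (h.lip.mul hv).integral_mul_deriv hu, h2, hv1]
  ring

/-- Integration by parts leaves no boundary term when `u(0) = 0` and `v(1) = 0`. The integral with
`b v'` is kept as it stands, because it will be split at the transition point and treated
differently on the two sides. -/
lemma abs_bilin_le_of_left_zero (hε : 0 ≤ ε) (h : Coef b c B) (hu : LipI u) (hv : LipI v)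
    (hu0 : u 0 = 0) (hv1 : v 1 = 0) :
    |bilin ε b c u v| ≤ ε * (semi1 u * semi1 v)
      + |∫ x in (0 : ℝ)..1, u x * (b x * deriv v x)| + 2 * B * (norm0 u * norm0 v) := by
  rw [bilin_eq h hu hv, integral_convection h hu hv hv1, hu0]
  have h1 : |ε * (∫ x in (0 : ℝ)..1, deriv u x * deriv v x)| ≤ ε * (semi1 u * semi1 v) := by
    rw [abs_mul, abs_of_nonneg hε]
    exact mul_le_mul_of_nonneg_left (abs_integral_mul_le_norm0 hu.bm_deriv hv.bm_deriv) hε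
  have h2 := abs_integral_mul_mul_le (BM.of_continuousOn h.cont) hu.bm hv.bm
      fun x hx => h.c_le x (Ioo_subset_Icc_self hx)
  have h3 := abs_integral_mul_mul_le h.lip.bm_deriv hu.bm hv.bm h.b'_le
  rw [abs_le] at *
  have h4 := abs_le.1 (le_refl |∫ x in (0 : ℝ)..1, u x * (b x * deriv v x)|)
  constructor <;> linarith [h1.1, h1.2, h2.1, h2.2, h3.1, h3.2, h4.1, h4.2]

/-- For `u = v = e` the integrated identity contains the original integral again, so that `2 ∫ b e'
e = -b(0) e(0)^2 - ∫ b' e^2`. The boundary term enters `a(e,e)` with a positive sign, `b(0) > 1`,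
and the terms with `b'` and `c` account for `3B`. -/
lemma sq_left_le (hε : 0 ≤ ε) (h : Coef b c B) (he : LipI e) (he1 : e 1 = 0) :
    e 0 ^ 2 ≤ 2 * bilin ε b c e e + 3 * B * norm0 e ^ 2 := by
  have h0 := bilin_eq (ε := ε) h he he
  have h1 := integral_convection h he he he1
  have h2 := abs_integral_mul_mul_le (BM.of_continuousOn h.cont) he.bm he.bm
      fun x hx => h.c_le x (Ioo_subset_Icc_self hx)
  have h3 := abs_integral_mul_mul_le h.lip.bm_deriv he.bm he.bm h.b'_le
  have h4 : ∫ x in (0 : ℝ)..1, e x * (b x * deriv e x) =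
      ∫ x in (0 : ℝ)..1, b x * deriv e x * e x := by
    congr 1; ext x; ring
  have h5 : 0 ≤ ε * (∫ x in (0 : ℝ)..1, deriv e x * deriv e x) :=
    mul_nonneg hε (intervalIntegral.integral_nonneg zero_le_one fun x _ => mul_self_nonneg _)
  have h6 : e 0 ^ 2 ≤ b 0 * e 0 * e 0 := by
    nlinarith [h.one_lt 0 (by simp), sq_nonneg (e 0)]
  rw [abs_le] at h2 h3
  rw [← sq] at h2 h3
  linarith [h2.1, h2.2, h3.1, h3.2]

/-- Coercivity in the form in which it is used for error estimates. -/
lemma epsNorm_le_of_bilin_le {δ : ℝ} (hε : 0 ≤ ε) (hγ : 0 < γ) (h : Coef b c B)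
    (hell : VElliptic ε b c γ) (he : LipI e) (he1 : e 1 = 0) (hδ : 0 ≤ δ)
    (hle : |bilin ε b c e e| ≤ δ * (epsNorm ε e + |e 0|)) :
    epsNorm ε e + |e 0| ≤ (2 / γ + 2 * (2 + 3 * B / γ)) * δ := by
  have hB := h.one_le
  have h1 := hell e ⟨he.memH1, he1⟩
  have h2 := sq_left_le hε h he he1
  set N := epsNorm ε e with hN
  have hN0 : 0 ≤ N := epsNorm_nonneg _ _
  set A := bilin ε b c e e
  have h3 : norm0 e ^ 2 ≤ N ^ 2 := pow_le_pow_left₀ (norm0_nonneg _) (norm0_le_epsNorm _ _) 2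
  have h4 : N ^ 2 ≤ A / γ := by rw [le_div_iff₀ hγ]; linarith
  have h5 : e 0 ^ 2 ≤ (2 + 3 * B / γ) * A := by
    have : 3 * B * norm0 e ^ 2 ≤ 3 * B * (A / γ) := by
      gcongr
      exact h3.trans h4
    calc e 0 ^ 2 ≤ 2 * A + 3 * B * (A / γ) := by linarith
      _ = _ := by ring
  have h6 : (N + |e 0|) ^ 2 ≤ (2 / γ + 2 * (2 + 3 * B / γ)) * A := by
    have : (N + |e 0|) ^ 2 ≤ 2 * N ^ 2 + 2 * e 0 ^ 2 := by
      rw [← sq_abs (e 0)]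
      nlinarith [sq_nonneg (N - |e 0|)]
    calc _ ≤ 2 * (A / γ) + 2 * ((2 + 3 * B / γ) * A) := by linarith
      _ = _ := by ring
  set K := 2 / γ + 2 * (2 + 3 * B / γ)
  have hK : 0 < K := by positivity
  set X := N + |e 0|
  have hX : 0 ≤ X := by positivity
  -- The left-hand side is quadratic in `X` and the assumed bound linear, so one factor `X` cancels
  -- when it is positive.
  have h7 : X ^ 2 ≤ K * δ * X := by
    calc X ^ 2 ≤ K * A := h6
      _ ≤ K * (δ * X) := by gcongr; exact (le_abs_self _).trans hle
      _ = _ := by ring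
  rcases hX.eq_or_lt with h8 | h8
  · rw [← h8]; positivity
  · nlinarith

end bilin

/-! ### Weak form of the problem and consistency of the reduced solution -/

section solution

variable {ε B γ : ℝ} {b c f u v : ℝ → ℝ}

lemma IsSolution.lipI (hu : IsSolution ε b c f u) : LipI u :=
  LipI.of_contDiffOn (by norm_num) hu.contDiffOn

/-- The weak form of the problem. -/
lemma IsSolution.bilin_eq (hu : IsSolution ε b c f u) (h : Coef b c B) (hv : LipI v)
    (hv1 : v 1 = 0) : bilin ε b c u v = ∫ x in (0 : ℝ)..1, f x * v x := by
  have hU := uniqueDiffOn_Icc (zero_lt_one' ℝ)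
  have hw : ContDiffOn ℝ 1 (derivWithin u (Icc 0 1)) (Icc 0 1) :=
    hu.contDiffOn.derivWithin hU (by norm_num)
  set w := derivWithin u (Icc 0 1) with hwd
  have hw0 : w 0 = 0 := hu.left_bc
  have hwL : LipI w := LipI.of_contDiffOn le_rfl hw
  have hwu : ∀ x ∈ Ioo (0 : ℝ) 1, w x = deriv u x := fun x hx =>
    derivWithin_of_mem_nhds (Icc_mem_nhds hx.1 hx.2)
  have hwu' : ∀ x ∈ Ioo (0 : ℝ) 1, deriv w x = deriv (deriv u) x := fun x hx =>
    Filter.EventuallyEq.deriv_eq (Filter.eventually_of_mem (Ioo_mem_nhds hx.1 hx.2) hwu)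
  -- Both boundary terms vanish: `w(0) = 0` is the Neumann condition, and `v(1) = 0`.
  have e1 : ∫ x in (0 : ℝ)..1, deriv u x * deriv v x = -∫ x in (0 : ℝ)..1, deriv w x * v x := by
    rw [← integral_congr_Ioo zero_le_one (ae_of_forall_Ioo fun x hx => by rw [← hwu x hx]),
      hwL.integral_mul_deriv hv, hv1, hw0]
    ring
  rw [WeakLayer.bilin_eq h hu.lipI hv, e1, mul_neg, ← intervalIntegral.integral_const_mul,
    ← intervalIntegral.integral_neg, ← intervalIntegral.integral_sub, ← intervalIntegral.integral_add]
  · refine integral_congr_Ioo zero_le_one (ae_of_forall_Ioo fun x hx => ?_)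
    rw [← hu.equation x hx, hwu' x hx]
    ring
  · exact (((hwL.bm_deriv.mul hv.bm).ii01.const_mul _).neg).sub
      ((h.lip.bm.mul hu.lipI.bm_deriv).mul hv.bm).ii01
  · exact (((BM.of_continuousOn h.cont).mul hu.lipI.bm).mul hv.bm).ii01
  · exact ((hwL.bm_deriv.mul hv.bm).ii01.const_mul _).neg
  · exact ((h.lip.bm.mul hu.lipI.bm_deriv).mul hv.bm).ii01

/-- Consistency error of the solution of the reduced problem. -/
lemma abs_bilin_sub_reduced_le {S : ℕ → ℝ → ℝ} {K : ℝ} (hε : 0 ≤ ε)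
    (hu : IsSolution ε b c f u) (h : Coef b c B)
    (hS : DerivFam S) (hS0 : ∀ x ∈ Icc (0 : ℝ) 1, -b x * S 1 x + c x * S 0 x = f x)
    (hK1 : ∀ x ∈ Icc (0 : ℝ) 1, |S 1 x| ≤ K) (hK2 : ∀ x ∈ Icc (0 : ℝ) 1, |S 2 x| ≤ K)
    (hv : LipI v) (hv1 : v 1 = 0) :
    |bilin ε b c (fun x => u x - S 0 x) v| ≤ K * ε * (epsNorm ε v + |v 0|) := by
  have dS : ∀ j, ∀ x ∈ Ioo (0 : ℝ) 1, deriv (S j) x = S (j + 1) x :=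
    fun j x hx => (hS.hasDerivAt j hx).deriv
  have e1 : ∫ x in (0 : ℝ)..1, deriv (S 0) x * deriv v x =
      - (S 1 0 * v 0) - ∫ x in (0 : ℝ)..1, S 2 x * v x := by
    rw [integral_congr_Ioo zero_le_one (ae_of_forall_Ioo fun x hx => by rw [dS 0 x hx]),
      zero_add, (hS.lipI 1).integral_mul_deriv hv, hv1,
      integral_congr_Ioo zero_le_one (ae_of_forall_Ioo fun x hx => by rw [dS 1 x hx])]
    ring
  -- `S` need not satisfy the Neumann condition, so the boundary term `ε S'(0) v(0)` survives.
  have e2 : bilin ε b c (fun x => u x - S 0 x) v =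
      ε * (S 1 0 * v 0) + ε * ∫ x in (0 : ℝ)..1, S 2 x * v x := by
    rw [bilin_sub h hu.lipI (hS.lipI 0) hv, hu.bilin_eq h hv hv1,
      WeakLayer.bilin_eq h (hS.lipI 0) hv, e1]
    have e3 : ∫ x in (0 : ℝ)..1, f x * v x = -(∫ x in (0 : ℝ)..1, b x * deriv (S 0) x * v x)
        + ∫ x in (0 : ℝ)..1, c x * S 0 x * v x := by
      rw [← intervalIntegral.integral_neg, ← intervalIntegral.integral_add]
      · refine integral_congr_Ioo zero_le_one (ae_of_forall_Ioo fun x hx => ?_)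
        rw [← hS0 x (Ioo_subset_Icc_self hx), dS 0 x hx]
        ring
      · exact ((h.lip.bm.mul (hS.lipI 0).bm_deriv).mul hv.bm).ii01.neg
      · exact (((BM.of_continuousOn h.cont).mul (hS.lipI 0).bm).mul hv.bm).ii01
    rw [e3]
    ring
  have hK : 0 ≤ K := (abs_nonneg _).trans (hK1 0 (by simp))
  have h2 : |∫ x in (0 : ℝ)..1, S 2 x * v x| ≤ K * epsNorm ε v := by
    refine (abs_integral_mul_le_norm0 (hS.lipI 2).bm hv.bm).trans ?_
    refine mul_le_mul (norm0_le (hS.lipI 2).bm hK (ae_of_forall_Ioo fun x hx =>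
      hK2 x (Ioo_subset_Icc_self hx))) (norm0_le_epsNorm _ _) (norm0_nonneg _) hK
  have h3 : |S 1 0 * v 0| ≤ K * |v 0| := by
    rw [abs_mul]
    exact mul_le_mul_of_nonneg_right (hK1 0 (by simp)) (abs_nonneg _)
  rw [e2, ← mul_add, abs_mul, abs_of_nonneg hε]
  calc _ ≤ ε * (K * |v 0| + K * epsNorm ε v) := by
        gcongr
        exact (abs_add_le _ _).trans (add_le_add h3 h2)
    _ = _ := by ring

end solution

/-! ### Local quasi-interpolation of functions with a layer -/

section interpolation

/-- The Taylor polynomial of degree `n` at `d`. -/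
noncomputable def taylorPoly (F : ℕ → ℝ → ℝ) (d : ℝ) (n : ℕ) : ℝ[X] :=
  ∑ j ∈ Finset.range (n + 1),
    Polynomial.C (F j d / (j.factorial : ℝ)) * (Polynomial.X - Polynomial.C d) ^ j

lemma natDegree_taylorPoly_le (F : ℕ → ℝ → ℝ) (d : ℝ) (n : ℕ) :
    (taylorPoly F d n).natDegree ≤ n := by
  refine Polynomial.natDegree_sum_le_of_forall_le _ _ fun j hj => ?_
  refine (Polynomial.natDegree_C_mul_le _ _).trans ?_
  rw [Polynomial.natDegree_pow, Polynomial.natDegree_X_sub_C, mul_one]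
  exact Nat.lt_succ_iff.1 (Finset.mem_range.1 hj)

lemma taylorPoly_eval_self (F : ℕ → ℝ → ℝ) (d : ℝ) (n : ℕ) :
    (taylorPoly F d n).eval d = F 0 d := by
  simp [taylorPoly, Finset.sum_range_succ', Polynomial.eval_finsetSum]

lemma derivative_taylorPoly (F : ℕ → ℝ → ℝ) (d : ℝ) (n : ℕ) :
    Polynomial.derivative (taylorPoly F d (n + 1)) = taylorPoly (fun j => F (j + 1)) d n := by
  unfold taylorPoly
  rw [Finset.sum_range_succ', Polynomial.derivative_add, Polynomial.derivative_sum]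
  simp only [pow_zero, mul_one, Polynomial.derivative_C, add_zero]
  refine Finset.sum_congr rfl fun j _ => ?_
  rw [Polynomial.derivative_C_mul, Polynomial.derivative_X_sub_C_pow, ← mul_assoc,
    ← Polynomial.C_mul]
  congr 2
  have : ((j + 1).factorial : ℝ) = (j + 1) * j.factorial := by
    rw [Nat.factorial_succ]; push_cast; ring
  rw [this]
  have h1 : (j.factorial : ℝ) ≠ 0 := by positivity
  push_cast
  field_simp

/-- The right-hand side minus `r` is nonincreasing and nonnegative at `d`. Integrating from the
right end turns `κ e^(-κx)` into `e^(-κx)`, with no factor from the length of the interval; the gain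
`1/(n+1)` from the power is discarded. -/
lemma le_of_neg_deriv_le {r r' : ℝ → ℝ} {a d M m κ : ℝ} {n : ℕ} (hM : 0 ≤ M) (hm : 0 ≤ m)
    (hc : ContinuousOn r (Icc a d)) (hr : ∀ x ∈ Ioo a d, HasDerivAt r (r' x) x) (h0 : r d = 0)
    (hb : ∀ x ∈ Ioo a d, -r' x ≤ M * (d - x) ^ n + m * κ * Real.exp (-(κ * x))) :
    ∀ x ∈ Icc a d, r x ≤ M * (d - x) ^ (n + 1) + m * Real.exp (-(κ * x)) := by
  intro x hx
  have hd : ∀ y ∈ Ioo a d, HasDerivAt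
      (fun y => M * (d - y) ^ (n + 1) + m * Real.exp (-(κ * y)) - r y)
      (M * (((n + 1 : ℕ) : ℝ) * (d - y) ^ n * (0 - 1)) +
        m * (Real.exp (-(κ * y)) * (-(κ * 1))) - r' y) y := by
    intro y hy
    have e1 := (((hasDerivAt_const y d).sub (hasDerivAt_id y)).pow (n + 1)).const_mul M
    have e2 := ((((hasDerivAt_id y).const_mul κ).neg).exp).const_mul m
    exact (e1.add e2).sub (hr y hy)
  have anti : AntitoneOn (fun y => M * (d - y) ^ (n + 1) + m * Real.exp (-(κ * y)) - r y)
      (Icc a d) := by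
    refine antitoneOn_of_hasDerivWithinAt_nonpos
      (f' := fun y => M * (((n + 1 : ℕ) : ℝ) * (d - y) ^ n * (0 - 1)) +
        m * (Real.exp (-(κ * y)) * (-(κ * 1))) - r' y) (convex_Icc a d)
      (ContinuousOn.sub (by fun_prop) hc) (fun y hy => ?_) (fun y hy => ?_)
    · rw [interior_Icc] at hy
      exact (hd y hy).hasDerivWithinAt
    · rw [interior_Icc] at hy
      have h1 := hb y hy
      have h2 : 0 ≤ M * (d - y) ^ n * n :=
        mul_nonneg (mul_nonneg hM (pow_nonneg (by linarith [hy.2]) n)) (Nat.cast_nonneg n)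
      push_cast
      linarith
  have := anti hx (right_mem_Icc.2 (hx.1.trans hx.2)) hx.2
  simp only [sub_self, h0, ne_eq, Nat.add_eq_zero_iff, one_ne_zero, and_false, not_false_eq_true,
    zero_pow, mul_zero, zero_add, sub_zero] at this
  have h3 : 0 ≤ m * Real.exp (-(κ * d)) := by positivity
  linarith

lemma abs_le_of_abs_deriv_le {r r' : ℝ → ℝ} {a d M m κ : ℝ} {n : ℕ} (hM : 0 ≤ M) (hm : 0 ≤ m)
    (hc : ContinuousOn r (Icc a d)) (hr : ∀ x ∈ Ioo a d, HasDerivAt r (r' x) x) (h0 : r d = 0)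
    (hb : ∀ x ∈ Ioo a d, |r' x| ≤ M * (d - x) ^ n + m * κ * Real.exp (-(κ * x))) :
    ∀ x ∈ Icc a d, |r x| ≤ M * (d - x) ^ (n + 1) + m * Real.exp (-(κ * x)) := by
  intro x hx
  rw [abs_le']
  refine ⟨le_of_neg_deriv_le hM hm hc hr h0 (fun y hy => (neg_le_abs _).trans (hb y hy)) x hx, ?_⟩
  refine le_of_neg_deriv_le (r := fun y => -r y) (r' := fun y => -r' y) hM hm hc.neg
    (fun y hy => (hr y hy).neg) (by simp [h0]) (fun y hy => ?_) x hx
  rw [neg_neg]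
  exact (le_abs_self _).trans (hb y hy)

/-- Taylor remainder at the right end point of an interval, for a function whose derivative of
order `n + 1` has a layer. -/
lemma abs_sub_taylorPoly_le {F : ℕ → ℝ → ℝ} (hF : DerivFam F) {a d M κ : ℝ} (ha : 0 ≤ a)
    (hd : d ≤ 1) (hM : 0 ≤ M) (hκ : 0 ≤ κ) (n : ℕ) {m : ℝ} (hm : 0 ≤ m)
    (hb : ∀ s ∈ Icc a d, |F (n + 1) s| ≤ M + m * κ ^ (n + 1) * Real.exp (-(κ * s))) :
    ∀ x ∈ Icc a d, |F 0 x - (taylorPoly F d n).eval x| ≤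
      M * (d - x) ^ (n + 1) + m * Real.exp (-(κ * x)) := by
  have key : ∀ (G : ℕ → ℝ → ℝ), DerivFam G → ∀ p : ℝ[X], ∀ x ∈ Ioo a d,
      HasDerivAt (fun y => G 0 y - p.eval y) (G 1 x - p.derivative.eval x) x :=
    fun G hG p x hx => (hG.hasDerivAt 0 ⟨ha.trans_lt hx.1, hx.2.trans_le hd⟩).sub (p.hasDerivAt x)
  have keyc : ∀ (G : ℕ → ℝ → ℝ), DerivFam G → ∀ p : ℝ[X],
      ContinuousOn (fun y => G 0 y - p.eval y) (Icc a d) :=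
    fun G hG p => ((hG.continuousOn 0).mono (Icc_subset_Icc ha hd)).sub p.continuous.continuousOn
  induction n generalizing F m with
  | zero =>
    refine abs_le_of_abs_deriv_le hM hm (keyc F hF _) (key F hF _)
      (by rw [taylorPoly_eval_self, sub_self]) fun x hx => ?_
    have := hb x (Ioo_subset_Icc_self hx)
    simpa [taylorPoly] using this
  | succ n ih =>
    refine abs_le_of_abs_deriv_le hM hm (keyc F hF _) (key F hF _)
      (by rw [taylorPoly_eval_self, sub_self]) fun x hx => ?_
    rw [derivative_taylorPoly]
    -- The derivative of the remainder is the remainder of the shifted family, with one factor `κ`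
    -- moved into `m`.
    refine ih (F := fun j => F (j + 1)) (m := m * κ) (hF.shift 1) (mul_nonneg hm hκ)
      (fun s hs => ?_) x (Ioo_subset_Icc_self hx)
    have := hb s hs
    rwa [pow_succ' κ (n + 1), ← mul_assoc] at this

/-- The local quasi-interpolant: it matches the values at both end points. -/
lemma exists_quasiInterp {F : ℕ → ℝ → ℝ} (hF : DerivFam F) {a d M κ : ℝ} (ha : 0 ≤ a)
    (had : a < d) (hd : d ≤ 1) (hM : 0 ≤ M) (hκ : 0 ≤ κ) {k : ℕ} (hk : 1 ≤ k) {m : ℝ} (hm : 0 ≤ m)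
    (hb : ∀ s ∈ Icc a d, |F (k + 1) s| ≤ M + m * κ ^ (k + 1) * Real.exp (-(κ * s))) :
    ∃ p : ℝ[X], p.natDegree ≤ k ∧ p.eval a = F 0 a ∧ p.eval d = F 0 d ∧
      (∀ x ∈ Icc a d, |F 0 x - p.eval x| ≤
        2 * (M * (d - a) ^ (k + 1) + m * Real.exp (-(κ * a)))) ∧
      (∀ x ∈ Icc a d, |F 1 x - p.derivative.eval x| ≤
        2 * M * (d - a) ^ k + m * κ * Real.exp (-(κ * x)) + m * Real.exp (-(κ * a)) / (d - a)) := by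
  have hl : 0 < d - a := sub_pos.2 had
  set T := taylorPoly F d k
  set ρ := F 0 a - T.eval a with hρ
  have h0 := abs_sub_taylorPoly_le hF ha hd hM hκ k hm hb
  obtain ⟨n, rfl⟩ : ∃ n, k = n + 1 := ⟨k - 1, by omega⟩
  have h1 := abs_sub_taylorPoly_le (F := fun j => F (j + 1)) (m := m * κ) (hF.shift 1) ha hd hM hκ
    n (mul_nonneg hm hκ) (fun s hs => by
      have := hb s hs
      rwa [pow_succ' κ (n + 1), ← mul_assoc] at this)
  rw [← derivative_taylorPoly] at h1
  have hρ' : |ρ| ≤ M * (d - a) ^ (n + 1 + 1) + m * Real.exp (-(κ * a)) :=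
    h0 a (left_mem_Icc.2 had.le)
  -- Linear correction: zero at `d`, and equal at `a` to the defect `ρ` of the Taylor polynomial.
  set q : ℝ[X] := Polynomial.C (ρ / (d - a)) * (Polynomial.C d - Polynomial.X) with hq
  have qe : ∀ x, q.eval x = ρ / (d - a) * (d - x) := fun x => by simp [hq]
  have qd : ∀ x, q.derivative.eval x = -(ρ / (d - a)) := fun x => by simp [hq]
  have qn : q.natDegree ≤ n + 1 := by
    refine (Polynomial.natDegree_C_mul_le _ _).trans ((Polynomial.natDegree_sub_le _ _).trans ?_)
    simp
  refine ⟨T + q, (Polynomial.natDegree_add_le _ _).trans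
    (max_le (natDegree_taylorPoly_le F d _) qn), ?_, ?_, ?_, ?_⟩
  · rw [Polynomial.eval_add, qe, div_mul_cancel₀ _ hl.ne', hρ]
    ring
  · rw [Polynomial.eval_add, qe, taylorPoly_eval_self]
    ring
  · intro x hx
    have hx1 : 0 ≤ d - x := by linarith [hx.2]
    have e1 : |ρ / (d - a) * (d - x)| ≤ |ρ| := by
      rw [abs_mul, abs_div, abs_of_pos hl, abs_of_nonneg hx1, div_mul_eq_mul_div,
        div_le_iff₀ hl]
      exact mul_le_mul_of_nonneg_left (by linarith [hx.1]) (abs_nonneg _)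
    have e2 : M * (d - x) ^ (n + 1 + 1) + m * Real.exp (-(κ * x)) ≤
        M * (d - a) ^ (n + 1 + 1) + m * Real.exp (-(κ * a)) := by
      gcongr
      · exact hx.1
      · exact hx.1
    rw [Polynomial.eval_add, qe, ← sub_sub]
    refine (abs_sub _ _).trans ?_
    linarith [h0 x hx]
  · intro x hx
    have hx1 : 0 ≤ d - x := by linarith [hx.2]
    -- The slope of the correction is the source of the term `m e^(-κa) / (d - a)` in the derivative
    -- bound.
    have e1 : |ρ / (d - a)| ≤ M * (d - a) ^ (n + 1) + m * Real.exp (-(κ * a)) / (d - a) := by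
      rw [abs_div, abs_of_pos hl, div_le_iff₀ hl, add_mul, div_mul_cancel₀ _ hl.ne']
      calc _ ≤ _ := hρ'
        _ = _ := by ring
    have e2 : M * (d - x) ^ (n + 1) ≤ M * (d - a) ^ (n + 1) := by
      gcongr
      exact hx.1
    rw [Polynomial.derivative_add, Polynomial.eval_add, qd, ← sub_sub, sub_neg_eq_add]
    refine (abs_add_le _ _).trans ?_
    have := h1 x hx
    simp only [zero_add] at this
    linarith

end interpolation

/-! ### Inverse inequalities for polynomials -/

section inverse

/-- Inverse inequality on the unit interval. -/
lemma exists_inverse_unit (k : ℕ) : ∃ C : ℝ, 0 ≤ C ∧ ∀ p : ℝ[X], p.natDegree ≤ k →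
    ∫ x in (0 : ℝ)..1, p.derivative.eval x ^ 2 ≤ C * ∫ x in (0 : ℝ)..1, p.eval x ^ 2 := by
  let P : (Fin (k + 1) → ℝ) → ℝ[X] := fun a => ∑ i, Polynomial.C (a i) * Polynomial.X ^ (i : ℕ)
  have Pe : ∀ a x, (P a).eval x = ∑ i, a i * x ^ (i : ℕ) := fun a x => by
    simp [P, Polynomial.eval_finsetSum]
  have Pd : ∀ a x, (P a).derivative.eval x = ∑ i, a i * (((i : ℕ) : ℝ) * x ^ ((i : ℕ) - 1)) :=
    fun a x => by simp [P, Polynomial.eval_finsetSum, Polynomial.derivative_X_pow]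
  have Psmul : ∀ (t : ℝ) a, P (t • a) = Polynomial.C t * P a := fun t a => by
    simp [P, Finset.mul_sum, mul_assoc]
  have cF : Continuous fun a => ∫ x in (0 : ℝ)..1, (P a).eval x ^ 2 := by
    apply intervalIntegral.continuous_parametric_intervalIntegral_of_continuous'
    simp only [Function.uncurry_def, Pe]
    fun_prop
  have cD : Continuous fun a => ∫ x in (0 : ℝ)..1, (P a).derivative.eval x ^ 2 := by
    apply intervalIntegral.continuous_parametric_intervalIntegral_of_continuous'
    simp only [Function.uncurry_def, Pd]
    fun_prop
  have Pne : ∀ a, a ≠ 0 → P a ≠ 0 := by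
    intro a ha h
    apply ha
    ext i
    show a i = 0
    have := congrArg (fun q => Polynomial.coeff q i) h
    simpa only [P, Polynomial.finsetSum_coeff, Polynomial.coeff_C_mul, Polynomial.coeff_X_pow,
      mul_ite, mul_one, mul_zero, Fin.val_inj, Finset.sum_ite_eq, Finset.mem_univ, if_true,
      Polynomial.coeff_zero] using this
  have pos : ∀ a, a ≠ 0 → 0 < ∫ x in (0 : ℝ)..1, (P a).eval x ^ 2 := by
    intro a ha
    refine intervalIntegral.integral_pos zero_lt_one (by fun_prop) (fun x _ => sq_nonneg _) ?_
    by_contra! hcon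
    refine Pne a ha (Polynomial.eq_zero_of_infinite_isRoot _ ?_)
    refine (Icc_infinite (zero_lt_one' ℝ)).mono fun x hx => ?_
    exact pow_eq_zero_iff (two_ne_zero) |>.1 (le_antisymm (hcon x hx) (sq_nonneg _))
  -- The quotient is homogeneous of degree zero in the coefficients, so its maximum over the compact
  -- unit sphere bounds it everywhere.
  have hcont : ContinuousOn (fun a => (∫ x in (0 : ℝ)..1, (P a).derivative.eval x ^ 2) /
      ∫ x in (0 : ℝ)..1, (P a).eval x ^ 2) (Metric.sphere (0 : Fin (k + 1) → ℝ) 1) :=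
    cD.continuousOn.div cF.continuousOn fun a ha =>
      (pos a (by rintro rfl; simp at ha)).ne'
  obtain ⟨C, hC⟩ := (isCompact_sphere (0 : Fin (k + 1) → ℝ) 1).exists_bound_of_continuousOn hcont
  refine ⟨max C 0, le_max_right _ _, fun p hp => ?_⟩
  let a : Fin (k + 1) → ℝ := fun i => p.coeff i
  have hpa : P a = p := by
    conv_rhs => rw [p.as_sum_range' (k + 1) (by omega), Finset.sum_range]
    simp [P, a, Polynomial.C_mul_X_pow_eq_monomial]
  by_cases ha : a = 0
  · have : p = 0 := by rw [← hpa, ha]; simp [P]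
    simp [this]
  have hn : 0 < ‖a‖ := norm_pos_iff.2 ha
  have hs : (‖a‖⁻¹ • a) ∈ Metric.sphere (0 : Fin (k + 1) → ℝ) 1 := by
    simp [norm_smul, inv_mul_cancel₀ hn.ne']
  have h1 := (le_abs_self _).trans (hC _ hs)
  simp only [Psmul, hpa, Polynomial.derivative_C_mul, Polynomial.eval_mul, Polynomial.eval_C,
    mul_pow, intervalIntegral.integral_const_mul] at h1
  rw [mul_div_mul_left _ _ (by positivity), div_le_iff₀ (hpa ▸ pos a ha)] at h1
  refine h1.trans (mul_le_mul_of_nonneg_right (le_max_left _ _) ?_)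
  exact intervalIntegral.integral_nonneg zero_le_one fun _ _ => sq_nonneg _

/-- Inverse inequality: on an interval of length `ℓ` the derivative costs a factor `ℓ⁻¹`. -/
lemma exists_inverse (k : ℕ) : ∃ C : ℝ, 0 ≤ C ∧ ∀ p : ℝ[X], p.natDegree ≤ k → ∀ a l : ℝ, 0 < l →
    l ^ 2 * ∫ x in a..(a + l), p.derivative.eval x ^ 2 ≤ C * ∫ x in a..(a + l), p.eval x ^ 2 := by
  obtain ⟨C, hC, h⟩ := exists_inverse_unit k
  refine ⟨C, hC, fun p hp a l hl => ?_⟩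
  set q : ℝ[X] := p.comp (Polynomial.C a + Polynomial.C l * Polynomial.X) with hq
  have qn : q.natDegree ≤ k := by
    refine Polynomial.natDegree_comp_le.trans ?_
    have : (Polynomial.C a + Polynomial.C l * Polynomial.X : ℝ[X]).natDegree ≤ 1 := by compute_degree
    calc _ ≤ k * 1 := Nat.mul_le_mul hp this
      _ = k := mul_one k
  have qe : ∀ x, q.eval x = p.eval (a + l * x) := fun x => by simp [hq]
  have qd : ∀ x, q.derivative.eval x = l * p.derivative.eval (a + l * x) := fun x => by
    simp [hq, Polynomial.derivative_comp]
  have := h q qn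
  simp only [qe, qd, mul_pow, intervalIntegral.integral_const_mul] at this
  rw [intervalIntegral.integral_comp_add_mul (fun y => p.derivative.eval y ^ 2) hl.ne',
    intervalIntegral.integral_comp_add_mul (fun y => p.eval y ^ 2) hl.ne'] at this
  simp only [mul_zero, add_zero, mul_one, smul_eq_mul] at this
  have h2 := mul_le_mul_of_nonneg_left this hl.le
  calc _ = l * (l ^ 2 * (l⁻¹ * ∫ x in a..(a + l), p.derivative.eval x ^ 2)) := by
        field_simp
    _ ≤ _ := h2
    _ = _ := by field_simp

end inverse

/-! ### Smooth solution of the reduced problem -/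

section reduced

lemma hasDerivWithinAt_primitive {g : ℝ → ℝ} (hg : ContinuousOn g (Icc 0 1)) :
    ∀ x ∈ Icc (0 : ℝ) 1, HasDerivWithinAt (fun y => ∫ t in (1 : ℝ)..y, g t) (g x) (Icc 0 1) x := by
  intro x hx
  have : Fact (x ∈ Icc (0 : ℝ) 1) := ⟨hx⟩
  refine intervalIntegral.integral_hasDerivWithinAt_right (t := Icc 0 1) ?_ ?_ (hg x hx)
  · refine (hg.mono ?_).intervalIntegrable
    rw [uIcc_of_ge hx.2]
    exact Icc_subset_Icc_left hx.1
  · exact hg.stronglyMeasurableAtFilter_nhdsWithin measurableSet_Icc x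

lemma contDiffOn_of_hasDerivWithinAt {F g : ℝ → ℝ} (hg : ContDiffOn ℝ ∞ g (Icc 0 1))
    (h : ∀ x ∈ Icc (0 : ℝ) 1, HasDerivWithinAt F (g x) (Icc 0 1) x) :
    ContDiffOn ℝ ∞ F (Icc 0 1) := by
  have hU := uniqueDiffOn_Icc (zero_lt_one' ℝ)
  rw [contDiffOn_infty_iff_derivWithin hU]
  exact ⟨fun x hx => (h x hx).differentiableWithinAt,
    hg.congr fun x hx => (h x hx).derivWithin (hU x hx)⟩

/-- The reduced problem `-b S' + c S = f`, `S(1) = 0` has a smooth solution. -/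
lemma exists_reduced {b c f : ℝ → ℝ} (hb : ContDiffOn ℝ ∞ b (Icc 0 1))
    (hc : ContDiffOn ℝ ∞ c (Icc 0 1)) (hf : ContDiffOn ℝ ∞ f (Icc 0 1))
    (hb1 : ∀ x ∈ Icc (0 : ℝ) 1, 1 < b x) :
    ∃ S : ℕ → ℝ → ℝ, DerivFam S ∧ S 0 1 = 0 ∧
      ∀ x ∈ Icc (0 : ℝ) 1, -b x * S 1 x + c x * S 0 x = f x := by
  have hb0 : ∀ x ∈ Icc (0 : ℝ) 1, b x ≠ 0 := fun x hx => by linarith [hb1 x hx]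
  have hcb : ContDiffOn ℝ ∞ (fun x => c x / b x) (Icc 0 1) := hc.div hb hb0
  have hG' := hasDerivWithinAt_primitive hcb.continuousOn
  set G : ℝ → ℝ := fun y => ∫ t in (1 : ℝ)..y, c t / b t
  have hG : ContDiffOn ℝ ∞ G (Icc 0 1) := contDiffOn_of_hasDerivWithinAt hcb hG'
  have hI : ContDiffOn ℝ ∞ (fun x => f x / b x * Real.exp (-G x)) (Icc 0 1) :=
    (hf.div hb hb0).mul hG.neg.exp
  have hJ' := hasDerivWithinAt_primitive hI.continuousOn
  set J : ℝ → ℝ := fun y => ∫ t in (1 : ℝ)..y, f t / b t * Real.exp (-G t) with hJd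
  have hJ : ContDiffOn ℝ ∞ J (Icc 0 1) := contDiffOn_of_hasDerivWithinAt hI hJ'
  -- Variation of constants with the factor `e^G`; the primitive `J` starts at `1`, which gives
  -- `S(1) = 0`.
  have hS : ContDiffOn ℝ ∞ (fun x => -(Real.exp (G x) * J x)) (Icc 0 1) := (hG.exp.mul hJ).neg
  refine ⟨_, DerivFam.of_contDiffOn hS, by simp [hJd], fun x hx => ?_⟩
  have hd := ((hG' x hx).exp.mul (hJ' x hx)).neg
  have e1 : iteratedDerivWithin 1 (fun x => -(Real.exp (G x) * J x)) (Icc 0 1) x =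
      -(Real.exp (G x) * (c x / b x) * J x +
        Real.exp (G x) * (f x / b x * Real.exp (-G x))) := by
    rw [iteratedDerivWithin_one]
    exact hd.derivWithin (uniqueDiffOn_Icc zero_lt_one x hx)
  rw [e1, iteratedDerivWithin_zero]
  have e2 : Real.exp (G x) * Real.exp (-G x) = 1 := by rw [← Real.exp_add]; simp
  have h0 := hb0 x hx
  field_simp
  linear_combination (f x) * e2

end reduced

/-! ### Pointwise derivative bounds with a weak layer -/

section layer

variable {ε B γ : ℝ} {b c f u : ℝ → ℝ}

lemma contDiffOn_succ_of_hasDerivWithinAt {F g : ℝ → ℝ} {n : ℕ}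
    (hg : ContDiffOn ℝ n g (Icc 0 1))
    (h : ∀ x ∈ Icc (0 : ℝ) 1, HasDerivWithinAt F (g x) (Icc 0 1) x) :
    ContDiffOn ℝ (n + 1 : ℕ) F (Icc 0 1) := by
  have hU := uniqueDiffOn_Icc (zero_lt_one' ℝ)
  push_cast
  rw [contDiffOn_succ_iff_derivWithin hU]
  exact ⟨fun x hx => (h x hx).differentiableWithinAt, fun h => by simp at h,
    hg.congr fun x hx => (h x hx).derivWithin (hU x hx)⟩

/-- The equation holds up to the boundary. -/
lemma IsSolution.hasDerivWithinAt (hu : IsSolution ε b c f u) (hε : 0 < ε)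
    (hb : ContinuousOn b (Icc 0 1)) (hc : ContinuousOn c (Icc 0 1))
    (hf : ContinuousOn f (Icc 0 1)) :
    ∀ x ∈ Icc (0 : ℝ) 1, HasDerivWithinAt (derivWithin u (Icc 0 1))
      (ε⁻¹ * (c x * u x - f x - b x * derivWithin u (Icc 0 1) x)) (Icc 0 1) x := by
  have hU := uniqueDiffOn_Icc (zero_lt_one' ℝ)
  have hw : ContDiffOn ℝ 1 (derivWithin u (Icc 0 1)) (Icc 0 1) :=
    hu.contDiffOn.derivWithin hU (by norm_num)
  set w := derivWithin u (Icc 0 1) with hwd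
  have hw' : ContinuousOn (derivWithin w (Icc 0 1)) (Icc 0 1) :=
    hw.continuousOn_derivWithin hU le_rfl
  have hr : ContinuousOn (fun x => ε⁻¹ * (c x * u x - f x - b x * w x)) (Icc 0 1) :=
    continuousOn_const.mul (((hc.mul hu.contDiffOn.continuousOn).sub hf).sub
      (hb.mul hw.continuousOn))
  have hwu : ∀ x ∈ Ioo (0 : ℝ) 1, w x = deriv u x := fun x hx =>
    derivWithin_of_mem_nhds (Icc_mem_nhds hx.1 hx.2)
  -- Both sides are continuous on the closed interval and agree inside, so the equation reaches the
  -- end points; its derivatives are needed at `x = 0`.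
  have heq : EqOn (derivWithin w (Icc 0 1)) (fun x => ε⁻¹ * (c x * u x - f x - b x * w x))
      (Icc 0 1) := by
    refine EqOn.of_subset_closure (s := Ioo 0 1) (fun x hx => ?_) hw' hr Ioo_subset_Icc_self
      (by rw [closure_Ioo zero_ne_one])
    have e : derivWithin w (Icc 0 1) x = deriv (deriv u) x := by
      rw [derivWithin_of_mem_nhds (Icc_mem_nhds hx.1 hx.2)]
      exact Filter.EventuallyEq.deriv_eq (Filter.eventually_of_mem (Ioo_mem_nhds hx.1 hx.2) hwu)
    simp only [e, hwu x hx, ← hu.equation x hx]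
    field_simp
    ring
  intro x hx
  have := (hw.differentiableOn one_ne_zero x hx).hasDerivWithinAt
  rwa [heq hx] at this

/-- Bootstrapping: the equation expresses the derivative of `u'` through `u` and `u'`, so both gain
one order at a time. -/
lemma IsSolution.contDiffOn_infty (hu : IsSolution ε b c f u) (hε : 0 < ε)
    (hb : ContDiffOn ℝ ∞ b (Icc 0 1)) (hc : ContDiffOn ℝ ∞ c (Icc 0 1))
    (hf : ContDiffOn ℝ ∞ f (Icc 0 1)) : ContDiffOn ℝ ∞ u (Icc 0 1) := by
  have h1 := hu.hasDerivWithinAt hε hb.continuousOn hc.continuousOn hf.continuousOn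
  have h2 : ∀ x ∈ Icc (0 : ℝ) 1, HasDerivWithinAt u (derivWithin u (Icc 0 1) x) (Icc 0 1) x :=
    fun x hx => (hu.contDiffOn.differentiableOn two_ne_zero x hx).hasDerivWithinAt
  have key : ∀ n : ℕ, ContDiffOn ℝ n u (Icc 0 1) ∧
      ContDiffOn ℝ n (derivWithin u (Icc 0 1)) (Icc 0 1) := by
    intro n
    induction n with
    | zero =>
      exact ⟨contDiffOn_zero.2 fun x hx => (h2 x hx).continuousWithinAt,
        contDiffOn_zero.2 fun x hx => (h1 x hx).continuousWithinAt⟩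
    | succ n ih =>
      refine ⟨contDiffOn_succ_of_hasDerivWithinAt ih.2 h2,
        contDiffOn_succ_of_hasDerivWithinAt ?_ h1⟩
      have le : ((n : ℕ) : WithTop ℕ∞) ≤ ∞ := by exact_mod_cast le_top
      exact contDiffOn_const.mul ((((hc.of_le le).mul ih.1).sub (hf.of_le le)).sub
        ((hb.of_le le).mul ih.2))
  exact _root_.contDiffOn_infty.2 fun n => (key n).1

/-- The equation differentiated `n` times. -/
lemma IsSolution.iterated_eq (hu : IsSolution ε b c f u) (hε : 0 < ε)
    (hb : ContDiffOn ℝ ∞ b (Icc 0 1)) (hc : ContDiffOn ℝ ∞ c (Icc 0 1))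
    (hf : ContDiffOn ℝ ∞ f (Icc 0 1)) (n : ℕ) {x : ℝ} (hx : x ∈ Icc (0 : ℝ) 1) :
    ε * iteratedDerivWithin (n + 2) u (Icc 0 1) x + b x * iteratedDerivWithin (n + 1) u (Icc 0 1) x
      = (∑ i ∈ Finset.range (n + 1), (n.choose i : ℝ) * iteratedDerivWithin i c (Icc 0 1) x *
          iteratedDerivWithin (n - i) u (Icc 0 1) x) - iteratedDerivWithin n f (Icc 0 1) x
        - ∑ i ∈ Finset.range n, (n.choose (i + 1) : ℝ) * iteratedDerivWithin (i + 1) b (Icc 0 1) x *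
          iteratedDerivWithin (n - (i + 1) + 1) u (Icc 0 1) x := by
  have hU := uniqueDiffOn_Icc (zero_lt_one' ℝ)
  have hS := hu.contDiffOn_infty hε hb hc hf
  have hw : ContDiffOn ℝ ∞ (derivWithin u (Icc 0 1)) (Icc 0 1) :=
    ((contDiffOn_infty_iff_derivWithin hU).1 hS).2
  have hd := hu.hasDerivWithinAt hε hb.continuousOn hc.continuousOn hf.continuousOn
  have le : ((n : ℕ) : WithTop ℕ∞) ≤ ∞ := by exact_mod_cast le_top
  have hb' := (hb.of_le le) x hx
  have hc' := (hc.of_le le) x hx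
  have hf' := (hf.of_le le) x hx
  have hu' := (hS.of_le le) x hx
  have hw' := (hw.of_le le) x hx
  have e1 : iteratedDerivWithin (n + 2) u (Icc 0 1) x =
      iteratedDerivWithin n (fun x => ε⁻¹ * (c x * u x - f x - b x * derivWithin u (Icc 0 1) x))
        (Icc 0 1) x := by
    rw [iteratedDerivWithin_succ', iteratedDerivWithin_succ']
    exact iteratedDerivWithin_congr (fun y hy => (hd y hy).derivWithin (hU y hy)) hx
  have e2 : iteratedDerivWithin n (fun x => ε⁻¹ * (c x * u x - f x -
        b x * derivWithin u (Icc 0 1) x)) (Icc 0 1) x =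
      ε⁻¹ * (iteratedDerivWithin n (c * u) (Icc 0 1) x - iteratedDerivWithin n f (Icc 0 1) x
        - iteratedDerivWithin n (b * derivWithin u (Icc 0 1)) (Icc 0 1) x) := by
    have := iteratedDerivWithin_const_smul hx hU ε⁻¹ (((hc'.mul hu').sub hf').sub (hb'.mul hw'))
    have h2 := iteratedDerivWithin_sub hx hU ((hc'.mul hu').sub hf') (hb'.mul hw')
    have h3 := iteratedDerivWithin_sub hx hU (hc'.mul hu') hf'
    calc _ = ε⁻¹ * iteratedDerivWithin n (c * u - f - b * derivWithin u (Icc 0 1)) (Icc 0 1) x :=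
          this
      _ = ε⁻¹ * (iteratedDerivWithin n (c * u - f) (Icc 0 1) x
        - iteratedDerivWithin n (b * derivWithin u (Icc 0 1)) (Icc 0 1) x) := by
          congr 1
      _ = _ := by congr 2
  have e3 := iteratedDerivWithin_mul hx hU hb' hw'
  -- The term of index `0` in the Leibniz sum is `b u^(n+1)`, which belongs to the left-hand side.
  rw [Finset.sum_range_succ'] at e3
  simp only [← iteratedDerivWithin_succ', Nat.choose_zero_right, Nat.cast_one, one_mul,
    iteratedDerivWithin_zero, Nat.sub_zero] at e3
  rw [e1, e2, iteratedDerivWithin_mul hx hU hc' hu', e3]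
  field_simp
  ring

/-- A first-order comparison principle. -/
lemma nonneg_of_first_order {z z' : ℝ → ℝ} (hε : 0 < ε) (hb : ContinuousOn b (Icc 0 1))
    (hz : ContinuousOn z (Icc 0 1)) (hz' : ∀ x ∈ Ioo (0 : ℝ) 1, HasDerivAt z (z' x) x)
    (h : ∀ x ∈ Ioo (0 : ℝ) 1, 0 ≤ ε * z' x + b x * z x) (h0 : 0 ≤ z 0) :
    ∀ x ∈ Icc (0 : ℝ) 1, 0 ≤ z x := by
  have hP := hasDerivWithinAt_primitive hb
  set P : ℝ → ℝ := fun y => ∫ t in (1 : ℝ)..y, b t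
  -- Integrating factor: the derivative of this product is `ε⁻¹ e^(P/ε) (ε z' + b z)`.
  have mono : MonotoneOn (fun x => Real.exp (ε⁻¹ * P x) * z x) (Icc 0 1) := by
    refine monotoneOn_of_hasDerivWithinAt_nonneg
      (f' := fun x => Real.exp (ε⁻¹ * P x) * (ε⁻¹ * b x) * z x + Real.exp (ε⁻¹ * P x) * z' x)
      (convex_Icc 0 1) ?_ (fun x hx => ?_) (fun x hx => ?_)
    · have : ContinuousOn P (Icc 0 1) := fun x hx => (hP x hx).continuousWithinAt
      exact (Real.continuous_exp.comp_continuousOn (continuousOn_const.mul this)).mul hz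
    · rw [interior_Icc] at hx ⊢
      have h1 := (hP x (Ioo_subset_Icc_self hx)).hasDerivAt (Icc_mem_nhds hx.1 hx.2)
      exact (((h1.const_mul ε⁻¹).exp).mul (hz' x hx)).hasDerivWithinAt
    · rw [interior_Icc] at hx
      have h1 := mul_nonneg (mul_nonneg (Real.exp_pos (ε⁻¹ * P x)).le (inv_pos.2 hε).le) (h x hx)
      calc _ ≤ _ := h1
        _ = _ := by field_simp; ring
  intro x hx
  have h1 := mono (left_mem_Icc.2 zero_le_one) hx hx.1
  have h2 : 0 ≤ Real.exp (ε⁻¹ * P 0) * z 0 := by positivity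
  exact nonneg_of_mul_nonneg_right (h2.trans h1) (Real.exp_pos _)

/-- Comparison with the barrier `W = K (1 + E)`, `E = ε^(-n) e^(-x/ε)`, applied to `W - w` and `W +
w`. Since `ε W' + b W = K b + K (b - 1) E`, it is enough that `G ≤ K` and `G ≤ K (β - 1)`. The
strict inequality `β > 1` is what admits the decay rate `1/ε`. -/
lemma abs_le_of_first_order {w w' : ℝ → ℝ} {β G K : ℝ} {n : ℕ} (hε : 0 < ε) (hε1 : ε ≤ 1)
    (hb : ContinuousOn b (Icc 0 1)) (hβ : 1 < β) (hbβ : ∀ x ∈ Icc (0 : ℝ) 1, β ≤ b x)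
    (hw : ContinuousOn w (Icc 0 1)) (hw' : ∀ x ∈ Ioo (0 : ℝ) 1, HasDerivAt w (w' x) x)
    (h : ∀ x ∈ Ioo (0 : ℝ) 1, |ε * w' x + b x * w x| ≤
      G * (1 + ε * ε⁻¹ ^ n * Real.exp (-(ε⁻¹ * x))))
    (h0 : |w 0| ≤ K * (1 + ε⁻¹ ^ n)) (hG : 0 ≤ G) (hGK : G ≤ K) (hGK' : G ≤ K * (β - 1)) :
    ∀ x ∈ Icc (0 : ℝ) 1, |w x| ≤ K * (1 + ε * ε⁻¹ ^ (n + 1) * Real.exp (-(ε⁻¹ * x))) := by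
  have hWd : ∀ x, HasDerivAt (fun x => K * (1 + ε⁻¹ ^ n * Real.exp (-(ε⁻¹ * x))))
      (K * (ε⁻¹ ^ n * (Real.exp (-(ε⁻¹ * x)) * (-(ε⁻¹ * 1))))) x := fun x =>
    ((((((hasDerivAt_id x).const_mul ε⁻¹).neg).exp).const_mul _).const_add 1).const_mul K
  have hWc : ContinuousOn (fun x => K * (1 + ε⁻¹ ^ n * Real.exp (-(ε⁻¹ * x)))) (Icc 0 1) :=
    fun x _ => (hWd x).continuousAt.continuousWithinAt
  have hsup : ∀ x ∈ Ioo (0 : ℝ) 1, |ε * w' x + b x * w x| ≤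
      ε * (K * (ε⁻¹ ^ n * (Real.exp (-(ε⁻¹ * x)) * (-(ε⁻¹ * 1))))) +
        b x * (K * (1 + ε⁻¹ ^ n * Real.exp (-(ε⁻¹ * x)))) := by
    intro x hx
    refine (h x hx).trans ?_
    set E := ε⁻¹ ^ n * Real.exp (-(ε⁻¹ * x)) with hE
    have hE0 : 0 ≤ E := by positivity
    have hb0 := hbβ x (Ioo_subset_Icc_self hx)
    have e1 : ε * (K * (ε⁻¹ ^ n * (Real.exp (-(ε⁻¹ * x)) * (-(ε⁻¹ * 1))))) = -(K * E) := by
      rw [hE]; field_simp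
    have e2 : ε * ε⁻¹ ^ n * Real.exp (-(ε⁻¹ * x)) = ε * E := by rw [hE]; ring
    rw [e1, e2]
    have h1 : G * (ε * E) ≤ K * (β - 1) * E := by
      have : ε * E ≤ E := mul_le_of_le_one_left hE0 hε1
      exact (mul_le_mul_of_nonneg_left this hG).trans (mul_le_mul_of_nonneg_right hGK' hE0)
    have hK : 0 ≤ K := hG.trans hGK
    have h2 : K * β * (1 + E) ≤ K * b x * (1 + E) := by gcongr
    have h3 : K ≤ K * β := le_mul_of_one_le_right hK hβ.le
    nlinarith
  have hexp : ∀ x, ε * ε⁻¹ ^ (n + 1) * Real.exp (-(ε⁻¹ * x)) =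
      ε⁻¹ ^ n * Real.exp (-(ε⁻¹ * x)) := fun x => by
    rw [pow_succ]; field_simp
  have h00 := abs_le.1 h0
  intro x hx
  rw [hexp, abs_le']
  constructor
  · have := nonneg_of_first_order (z := fun x => K * (1 + ε⁻¹ ^ n * Real.exp (-(ε⁻¹ * x))) - w x)
      hε hb (hWc.sub hw) (fun x hx => (hWd x).sub (hw' x hx)) (fun x hx => by
        have := (le_abs_self _).trans (hsup x hx)
        linarith) (by
        simp only [mul_zero, neg_zero, Real.exp_zero, mul_one]
        linarith) x hx
    simpa using this
  · have := nonneg_of_first_order (z := fun x => K * (1 + ε⁻¹ ^ n * Real.exp (-(ε⁻¹ * x))) + w x)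
      hε hb (hWc.add hw) (fun x hx => (hWd x).add (hw' x hx)) (fun x hx => by
        have := (neg_le_abs _).trans (hsup x hx)
        linarith) (by
        simp only [mul_zero, neg_zero, Real.exp_zero, mul_one]
        linarith) x hx
    linarith

/-- Uniform boundedness of the solutions. -/
lemma IsSolution.abs_le (hu : IsSolution ε b c f u) (hε : 0 < ε) (hγ : 0 < γ)
    (hb : ContDiffOn ℝ ∞ b (Icc 0 1)) (hc : ContDiffOn ℝ ∞ c (Icc 0 1))
    (hf : ContDiffOn ℝ ∞ f (Icc 0 1)) (h : Coef b c B)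
    (hell : VElliptic ε b c γ) {F : ℝ} (hF : ∀ x ∈ Icc (0 : ℝ) 1, |f x| ≤ F) :
    ∀ x ∈ Icc (0 : ℝ) 1, |u x| ≤ B * (F / γ) + F := by
  have hB := h.one_le
  have hF0 : 0 ≤ F := (abs_nonneg _).trans (hF 0 (by simp))
  have hL := hu.lipI
  have hfm := BM.of_continuousOn hf.continuousOn
  have hcm := BM.of_continuousOn hc.continuousOn
  have hfF : norm0 f ≤ F := norm0_le hfm hF0
    (ae_of_forall_Ioo fun x hx => hF x (Ioo_subset_Icc_self hx))
  have hu0 : norm0 u ≤ F / γ := by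
    refine (norm0_le_epsNorm ε u).trans ?_
    have h1 := hell u ⟨hL.memH1, hu.right_bc⟩
    rw [hu.bilin_eq h hL hu.right_bc] at h1
    have h2 := (le_abs_self _).trans (abs_integral_mul_le_norm0 hfm hL.bm)
    have h3 : norm0 f * norm0 u ≤ F * epsNorm ε u :=
      mul_le_mul hfF (norm0_le_epsNorm _ _) (norm0_nonneg _) hF0
    rw [le_div_iff₀ hγ]
    rcases (epsNorm_nonneg ε u).eq_or_lt with h4 | h4
    · rw [← h4]; simpa using hF0
    · nlinarith
  have hw := hu.hasDerivWithinAt hε hb.continuousOn hc.continuousOn hf.continuousOn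
  have hcw : ContinuousOn (fun x => ε⁻¹ * (c x * u x - f x - b x * derivWithin u (Icc 0 1) x))
      (Icc 0 1) :=
    continuousOn_const.mul (((hc.continuousOn.mul hL.continuousOn).sub hf.continuousOn).sub
      (hb.continuousOn.mul fun x hx => (hw x hx).continuousWithinAt))
  have hwL : LipI (derivWithin u (Icc 0 1)) := LipI.of_hasDerivWithinAt hw hcw
  have hwu : ∀ x ∈ Ioo (0 : ℝ) 1, derivWithin u (Icc 0 1) x = deriv u x := fun x hx =>
    derivWithin_of_mem_nhds (Icc_mem_nhds hx.1 hx.2)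
  set w := derivWithin u (Icc 0 1)
  have hw0 : w 0 = 0 := hu.left_bc
  have hw' : ∀ x ∈ Ioo (0 : ℝ) 1, deriv w x = ε⁻¹ * (c x * u x - f x - b x * w x) := fun x hx =>
    ((hw x (Ioo_subset_Icc_self hx)).hasDerivAt (Icc_mem_nhds hx.1 hx.2)).deriv
  -- As `w(0) = 0`, the integral is `w(1)^2 / 2`. Testing the equation with `w = u'` then bounds
  -- `|u'|₀` independently of `ε`, because `b > 1`; integration from `x` to `1` bounds `u`.
  have e1 : 0 ≤ ∫ x in (0 : ℝ)..1, deriv w x * w x := by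
    have := hwL.integral_mul_deriv hwL
    have h2 : ∫ x in (0 : ℝ)..1, w x * deriv w x = ∫ x in (0 : ℝ)..1, deriv w x * w x := by
      congr 1; ext x; ring
    rw [h2, hw0] at this
    nlinarith [mul_self_nonneg (w 1)]
  have e2 : norm0 w ^ 2 ≤ (B * norm0 u + F) * norm0 w := by
    have i1 := ((hcm.mul hL.bm).mul hwL.bm)
    have i2 := hfm.mul hwL.bm
    have h1 : norm0 w ^ 2 ≤ ∫ x in (0 : ℝ)..1,
        (c x * u x * w x - f x * w x - ε * (deriv w x * w x)) := by
      rw [norm0_sq]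
      refine integral_le_of_ae_Ioo zero_le_one (hwL.bm.pow 2).ii01
        ((i1.sub i2).sub ((BM.const ε).mul (hwL.bm_deriv.mul hwL.bm))).ii01
        (ae_of_forall_Ioo fun x hx => ?_)
      rw [hw' x hx]
      have hb1 := h.one_lt x (Ioo_subset_Icc_self hx)
      have : c x * u x * w x - f x * w x - ε * (ε⁻¹ * (c x * u x - f x - b x * w x) * w x) =
          b x * w x ^ 2 := by field_simp; ring
      rw [this]
      nlinarith [sq_nonneg (w x)]
    rw [intervalIntegral.integral_sub (i1.sub i2).ii01
      ((hwL.bm_deriv.mul hwL.bm).ii01.const_mul ε), intervalIntegral.integral_sub i1.ii01 i2.ii01,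
      intervalIntegral.integral_const_mul] at h1
    have h2 := (le_abs_self _).trans (abs_integral_mul_mul_le hcm hL.bm hwL.bm
      fun x hx => h.c_le x (Ioo_subset_Icc_self hx))
    have h3 := (neg_le_abs _).trans (abs_integral_mul_le_norm0 hfm hwL.bm)
    have h4 := mul_le_mul_of_nonneg_right hfF (norm0_nonneg w)
    have h5 := mul_nonneg hε.le e1
    linarith
  have e3 : norm0 w ≤ B * (F / γ) + F := by
    have : norm0 w ≤ B * norm0 u + F := by
      rcases (norm0_nonneg w).eq_or_lt with h4 | h4
      · rw [← h4]
        have := norm0_nonneg u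
        positivity
      · nlinarith
    have h5 : B * norm0 u ≤ B * (F / γ) := by gcongr
    linarith
  intro x hx
  refine le_trans ?_ e3
  have hac := hL.ac.mono (c := x) (d := 1) (by
    rw [uIcc_of_le hx.2, uIcc_of_le zero_le_one]
    exact Icc_subset_Icc_left hx.1)
  have e4 := hac.integral_deriv_eq_sub
  rw [hu.right_bc, zero_sub] at e4
  have e5 : ∫ y in x..1, deriv u y = ∫ y in x..1, 1 * w y :=
    integral_congr_Ioo hx.2 (ae_of_forall_Ioo fun y hy => by
      rw [one_mul, hwu y ⟨hx.1.trans_lt hy.1, hy.2⟩])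
  rw [← abs_neg, ← e4, e5]
  refine (abs_integral_mul_le (BM.const 1) hwL.bm hx.1 hx.2 le_rfl).trans ?_
  have e6 : Real.sqrt (∫ y in x..1, (1 : ℝ) ^ 2) ≤ 1 :=
    sqrt_integral_sq_le (BM.const 1) hx.1 hx.2 le_rfl zero_le_one
      (ae_of_forall_Ioo fun _ _ => by simp)
  have e7 : Real.sqrt (∫ y in x..1, w y ^ 2) ≤ norm0 w := by
    apply Real.sqrt_le_sqrt
    refine intervalIntegral.integral_mono_interval hx.1 hx.2 le_rfl
      (Filter.Eventually.of_forall fun y => sq_nonneg _) (hwL.bm.pow 2).ii01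
  calc _ ≤ 1 * norm0 w := mul_le_mul e6 e7 (Real.sqrt_nonneg _) zero_le_one
    _ = _ := one_mul _

/-- The right-hand sides of the differentiated equations inherit layer bounds. -/
lemma exists_rhs_bound (hb : ContDiffOn ℝ ∞ b (Icc 0 1)) (hc : ContDiffOn ℝ ∞ c (Icc 0 1))
    (hf : ContDiffOn ℝ ∞ f (Icc 0 1)) (n : ℕ) {C : ℝ} (hC : 0 ≤ C) :
    ∃ G, 0 ≤ G ∧ ∀ ε, 0 < ε → ε ≤ 1 → ∀ u, IsSolution ε b c f u →
      (∀ j ≤ n, ∀ x ∈ Icc (0 : ℝ) 1, |iteratedDerivWithin j u (Icc 0 1) x| ≤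
        C * (1 + ε * ε⁻¹ ^ j * Real.exp (-(ε⁻¹ * x)))) →
      ∀ x ∈ Icc (0 : ℝ) 1, |ε * iteratedDerivWithin (n + 2) u (Icc 0 1) x +
        b x * iteratedDerivWithin (n + 1) u (Icc 0 1) x| ≤
          G * (1 + ε * ε⁻¹ ^ n * Real.exp (-(ε⁻¹ * x))) := by
  choose Kb hKb0 hKb using (DerivFam.of_contDiffOn hb).bound
  choose Kc hKc0 hKc using (DerivFam.of_contDiffOn hc).bound
  choose Kf hKf0 hKf using (DerivFam.of_contDiffOn hf).bound
  refine ⟨(∑ i ∈ Finset.range (n + 1), (n.choose i : ℝ) * Kc i * C) + Kf n +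
    ∑ i ∈ Finset.range n, (n.choose (i + 1) : ℝ) * Kb (i + 1) * C, ?_, ?_⟩
  · have h1 : ∀ i ∈ Finset.range (n + 1), 0 ≤ (n.choose i : ℝ) * Kc i * C := fun i _ => by
      have := hKc0 i
      positivity
    have h2 : ∀ i ∈ Finset.range n, 0 ≤ (n.choose (i + 1) : ℝ) * Kb (i + 1) * C := fun i _ => by
      have := hKb0 (i + 1)
      positivity
    have := hKf0 n
    have := Finset.sum_nonneg h1
    have := Finset.sum_nonneg h2
    positivity
  intro ε hε hε1 u hu hj x hx
  have hκ : 1 ≤ ε⁻¹ := (one_le_inv₀ hε).2 hε1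
  rw [hu.iterated_eq hε hb hc hf n hx, add_mul, add_mul, Finset.sum_mul, Finset.sum_mul]
  set Λ := 1 + ε * ε⁻¹ ^ n * Real.exp (-(ε⁻¹ * x)) with hΛ
  have hΛ1 : 1 ≤ Λ := by
    have : 0 ≤ ε * ε⁻¹ ^ n * Real.exp (-(ε⁻¹ * x)) := by positivity
    linarith
  have hU : ∀ j ≤ n, |iteratedDerivWithin j u (Icc 0 1) x| ≤ C * Λ := fun j hjn => by
    refine (hj j hjn x hx).trans ?_
    rw [hΛ]
    gcongr
  refine (abs_sub _ _).trans (add_le_add ((abs_sub _ _).trans (add_le_add ?_ ?_)) ?_)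
  · refine (Finset.abs_sum_le_sum_abs _ _).trans (Finset.sum_le_sum fun i _ => ?_)
    rw [abs_mul, abs_mul, Nat.abs_cast, mul_assoc _ C]
    have := hKc0 i
    exact mul_le_mul (mul_le_mul_of_nonneg_left (hKc i x hx) (Nat.cast_nonneg _))
      (hU _ (Nat.sub_le _ _)) (abs_nonneg _) (by positivity)
  · exact (hKf n x hx).trans (le_mul_of_one_le_right (hKf0 n).le hΛ1)
  · refine (Finset.abs_sum_le_sum_abs _ _).trans (Finset.sum_le_sum fun i hi => ?_)
    rw [abs_mul, abs_mul, Nat.abs_cast, mul_assoc _ C]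
    have := hKb0 (i + 1)
    have hin := Finset.mem_range.1 hi
    exact mul_le_mul (mul_le_mul_of_nonneg_left (hKb (i + 1) x hx) (Nat.cast_nonneg _))
      (hU _ (by omega)) (abs_nonneg _) (by positivity)

/-- Pointwise bounds for the derivatives of the solution: a smooth part and a weak layer. -/
theorem exists_layer_bound (hb : ContDiffOn ℝ ∞ b (Icc 0 1)) (hc : ContDiffOn ℝ ∞ c (Icc 0 1))
    (hf : ContDiffOn ℝ ∞ f (Icc 0 1)) (hb1 : ∀ x ∈ Icc (0 : ℝ) 1, 1 < b x) (hγ : 0 < γ) (n : ℕ) :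
    ∃ C, 0 < C ∧ ∀ ε, 0 < ε → ε ≤ 1 → VElliptic ε b c γ → ∀ u, IsSolution ε b c f u →
      ∀ j ≤ n, ∀ x ∈ Icc (0 : ℝ) 1, |iteratedDerivWithin j u (Icc 0 1) x| ≤
        C * (1 + ε * ε⁻¹ ^ j * Real.exp (-(ε⁻¹ * x))) := by
  obtain ⟨B, hco⟩ := exists_coef (LipI.of_contDiffOn (by exact_mod_cast le_top) hb)
    hc.continuousOn hb1
  have hB := hco.one_le
  obtain ⟨x₀, hx₀, hmin⟩ := isCompact_Icc.exists_isMinOn (nonempty_Icc.2 (zero_le_one' ℝ))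
    hb.continuousOn
  set β := b x₀
  have hβ : 1 < β := hb1 x₀ hx₀
  induction n with
  | zero =>
    obtain ⟨F, hF0, hF⟩ := (DerivFam.of_contDiffOn hf).bound 0
    simp only [iteratedDerivWithin_zero] at hF
    refine ⟨B * (F / γ) + F, by positivity, fun ε hε hε1 hell u hu j hj x hx => ?_⟩
    obtain rfl : j = 0 := by omega
    rw [iteratedDerivWithin_zero]
    refine (hu.abs_le hε hγ hb hc hf hco hell hF x hx).trans ?_
    refine le_mul_of_one_le_right (by positivity) ?_
    have : 0 ≤ ε * ε⁻¹ ^ 0 * Real.exp (-(ε⁻¹ * x)) := by positivity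
    linarith
  | succ n ih =>
    obtain ⟨C, hC, hCb⟩ := ih
    obtain ⟨G, hG, hGb⟩ := exists_rhs_bound hb hc hf n hC.le
    -- Used only for `n ≥ 1`, to bound the initial value; for `n = 0` the truncated difference is
    -- harmless, since `u'(0) = 0` is given.
    obtain ⟨G', hG', hGb'⟩ := exists_rhs_bound hb hc hf (n - 1) hC.le
    -- The summands serve, in this order, `G ≤ K`, `G ≤ K (β - 1)` and the bound of the initial
    -- value.
    set K := G + G / (β - 1) + 2 * (G' + B * C) with hK
    have hβ' : 0 < β - 1 := by linarith
    have hGβ : 0 ≤ G / (β - 1) := by positivity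
    have hK0 : 0 < K := by positivity
    refine ⟨C + K, by positivity, fun ε hε hε1 hell u hu j hj => ?_⟩
    have hκ : 1 ≤ ε⁻¹ := (one_le_inv₀ hε).2 hε1
    have hS := hu.contDiffOn_infty hε hb hc hf
    have hfam := DerivFam.of_contDiffOn hS
    have main : ∀ x ∈ Icc (0 : ℝ) 1, |iteratedDerivWithin (n + 1) u (Icc 0 1) x| ≤
        K * (1 + ε * ε⁻¹ ^ (n + 1) * Real.exp (-(ε⁻¹ * x))) := by
      refine abs_le_of_first_order (w' := iteratedDerivWithin (n + 2) u (Icc 0 1)) hε hε1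
        hb.continuousOn hβ (fun x hx => hmin hx) (hfam.continuousOn (n + 1))
        (fun x hx => hfam.hasDerivAt (n + 1) hx)
        (fun x hx => hGb ε hε hε1 u hu (hCb ε hε hε1 hell u hu) x (Ioo_subset_Icc_self hx))
        ?_ hG ?_ ?_
      · rcases n with _ | m
        · rw [zero_add, iteratedDerivWithin_one, hu.left_bc, abs_zero]
          positivity
        · have h1 := hGb' ε hε hε1 u hu
            (fun j hj => hCb ε hε hε1 hell u hu j (by omega)) 0 (by simp)
          have h2 := hCb ε hε hε1 hell u hu (m + 1) le_rfl 0 (by simp)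
          have h3 := hco.b_le 0 (by simp)
          simp only [Nat.add_sub_cancel, mul_zero, neg_zero, Real.exp_zero, mul_one] at h1 h2
          have e1 : ε * ε⁻¹ ^ (m + 1) = ε⁻¹ ^ m := by rw [pow_succ]; field_simp
          rw [e1] at h2
          have e2 : ε * ε⁻¹ ^ m ≤ ε⁻¹ ^ m := mul_le_of_le_one_left (by positivity) hε1
          have e3 : (1 : ℝ) ≤ ε⁻¹ ^ m := one_le_pow₀ hκ
          have h4 : |b 0 * iteratedDerivWithin (m + 1) u (Icc 0 1) 0| ≤
              B * (C * (1 + ε⁻¹ ^ m)) := by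
            rw [abs_mul]
            exact mul_le_mul h3 h2 (abs_nonneg _) (by linarith)
          -- The equation differentiated `m` times, read at `x = 0`, yields the initial value of the
          -- next derivative at the cost of one factor `ε⁻¹`.
          have h5 : |ε * iteratedDerivWithin (m + 2) u (Icc 0 1) 0| ≤
              2 * (G' + B * C) * ε⁻¹ ^ m := by
            have h6 := abs_sub (ε * iteratedDerivWithin (m + 2) u (Icc 0 1) 0 +
              b 0 * iteratedDerivWithin (m + 1) u (Icc 0 1) 0)
              (b 0 * iteratedDerivWithin (m + 1) u (Icc 0 1) 0)
            rw [add_sub_cancel_right] at h6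
            refine h6.trans ((add_le_add h1 h4).trans ?_)
            have h7 : G' * (1 + ε * ε⁻¹ ^ m) ≤ G' * (2 * ε⁻¹ ^ m) := by
              gcongr; linarith
            have h8 : B * (C * (1 + ε⁻¹ ^ m)) ≤ B * (C * (2 * ε⁻¹ ^ m)) := by
              gcongr; linarith
            linarith
          rw [abs_mul, abs_of_pos hε] at h5
          have h6 : |iteratedDerivWithin (m + 2) u (Icc 0 1) 0| ≤
              2 * (G' + B * C) * ε⁻¹ ^ (m + 1) := by
            have := mul_le_mul_of_nonneg_left h5 (inv_pos.2 hε).le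
            calc _ = ε⁻¹ * (ε * |iteratedDerivWithin (m + 2) u (Icc 0 1) 0|) := by field_simp
              _ ≤ _ := this
              _ = _ := by rw [pow_succ]; ring
          refine h6.trans ?_
          have h7 : 2 * (G' + B * C) ≤ K := by rw [hK]; linarith
          have h8 : (0 : ℝ) ≤ ε⁻¹ ^ (m + 1) := by positivity
          nlinarith
      · have : 0 ≤ 2 * (G' + B * C) := by positivity
        linarith
      · have h1 : G / (β - 1) ≤ K := by
          have : 0 ≤ 2 * (G' + B * C) := by positivity
          linarith
        rwa [div_le_iff₀ hβ'] at h1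
    intro x hx
    have hpos : 0 ≤ 1 + ε * ε⁻¹ ^ j * Real.exp (-(ε⁻¹ * x)) := by positivity
    rcases Nat.lt_or_ge j (n + 1) with hj' | hj'
    · refine (hCb ε hε hε1 hell u hu j (by omega) x hx).trans ?_
      exact mul_le_mul_of_nonneg_right (by linarith) hpos
    · obtain rfl : j = n + 1 := by omega
      exact (main x hx).trans (mul_le_mul_of_nonneg_right (by linarith) hpos)

end layer

/-! ### Piecewise polynomials on a partition -/

section partition

lemma exists_glue (x : ℕ → ℝ) (hx : StrictMono x) (p : ℕ → ℝ[X]) (N : ℕ)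
    (hp : ∀ i, i + 1 < N → (p i).eval (x (i + 1)) = (p (i + 1)).eval (x (i + 1))) :
    ∃ v : ℝ → ℝ, ∀ i < N, ∀ y ∈ Icc (x i) (x (i + 1)), v y = (p i).eval y := by
  induction N with
  | zero => exact ⟨0, fun i hi => by omega⟩
  | succ n ih =>
    obtain ⟨v, hv⟩ := ih fun i hi => hp i (by omega)
    -- The guard `0 < n` discards the empty gluing, whose value at the first node is meaningless.
    refine ⟨fun y => if y ≤ x n ∧ 0 < n then v y else (p n).eval y, fun i hi y hy => ?_⟩
    show (if y ≤ x n ∧ 0 < n then v y else (p n).eval y) = _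
    rcases Nat.lt_or_ge i n with h | h
    · rw [if_pos ⟨hy.2.trans (hx.monotone h), by omega⟩]
      exact hv i h y hy
    · obtain rfl : i = n := by omega
      split_ifs with h1
      · obtain rfl : y = x i := le_antisymm h1.1 hy.1
        obtain ⟨m, rfl⟩ : ∃ m, i = m + 1 := ⟨i - 1, by omega⟩
        rw [← hp m (by omega)]
        exact hv m (by omega) _ ⟨(hx (Nat.lt_succ_self m)).le, le_rfl⟩
      · rfl

lemma lipschitzOnWith_union {v : ℝ → ℝ} {K : NNReal} {a b c : ℝ}
    (h1 : LipschitzOnWith K v (Icc a b)) (h2 : LipschitzOnWith K v (Icc b c)) :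
    LipschitzOnWith K v (Icc a c) := by
  have key : ∀ y ∈ Icc a c, ∀ z ∈ Icc a c, y ≤ z → dist (v y) (v z) ≤ K * dist y z := by
    intro y hy z hz hyz
    rcases le_total z b with hzb | hzb
    · exact h1.dist_le_mul y ⟨hy.1, hyz.trans hzb⟩ z ⟨hz.1, hzb⟩
    rcases le_total b y with hyb | hyb
    · exact h2.dist_le_mul y ⟨hyb, hy.2⟩ z ⟨hzb, hz.2⟩
    have e1 := h1.dist_le_mul y ⟨hy.1, hyb⟩ b ⟨hy.1.trans hyb, le_rfl⟩
    have e2 := h2.dist_le_mul b ⟨le_rfl, hzb.trans hz.2⟩ z ⟨hzb, hz.2⟩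
    refine (dist_triangle _ (v b) _).trans ((add_le_add e1 e2).trans ?_)
    rw [← mul_add, Real.dist_eq, Real.dist_eq, Real.dist_eq, abs_of_nonpos (by linarith),
      abs_of_nonpos (by linarith), abs_of_nonpos (by linarith)]
    exact mul_le_mul_of_nonneg_left (by linarith) K.2
  refine LipschitzOnWith.of_dist_le_mul fun y hy z hz => ?_
  rcases le_total y z with h | h
  · exact key y hy z hz h
  · rw [dist_comm (v y), dist_comm y]
    exact key z hz y hy h

/-- The cells are closed, so neighbouring polynomials agree at the common node and no jump can
occur; the Lipschitz bounds of the cells combine. -/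
lemma exists_lipschitz_of_piecewise {v : ℝ → ℝ} (x : ℕ → ℝ) (N : ℕ)
    (hv : ∀ i < N, ∃ p : ℝ[X], ∀ y ∈ Icc (x i) (x (i + 1)), v y = p.eval y) :
    ∃ K, LipschitzOnWith K v (Icc (x 0) (x N)) := by
  induction N with
  | zero =>
    refine ⟨0, LipschitzOnWith.of_dist_le_mul fun y hy z hz => ?_⟩
    rw [Icc_self, mem_singleton_iff] at hy hz
    simp [hy, hz]
  | succ n ih =>
    obtain ⟨K, hK⟩ := ih fun i hi => hv i (by omega)
    obtain ⟨p, hp⟩ := hv n (by omega)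
    obtain ⟨C, hC⟩ := (isCompact_Icc (a := x n) (b := x (n + 1))).exists_bound_of_continuousOn
      (f := fun y => p.derivative.eval y) (by fun_prop)
    have h2 : LipschitzOnWith C.toNNReal v (Icc (x n) (x (n + 1))) := by
      have : LipschitzOnWith C.toNNReal (fun y => p.eval y) (Icc (x n) (x (n + 1))) := by
        refine Convex.lipschitzOnWith_of_nnnorm_hasDerivWithin_le (convex_Icc _ _)
          (fun y _ => (p.hasDerivAt y).hasDerivWithinAt) fun y hy => ?_
        rw [← NNReal.coe_le_coe, coe_nnnorm]
        exact (hC y hy).trans (Real.le_coe_toNNReal C)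
      refine LipschitzOnWith.of_dist_le_mul fun y hy z hz => ?_
      rw [hp y hy, hp z hz]
      exact this.dist_le_mul y hy z hz
    exact ⟨max K C.toNNReal, lipschitzOnWith_union (hK.weaken (le_max_left _ _))
      (h2.weaken (le_max_right _ _))⟩

/-- The nodes are countable, so bounds in the interior of the cells become bounds almost everywhere.
-/
lemma exists_cell {x : ℕ → ℝ} {m n : ℕ} (hmn : m ≤ n) {y : ℝ} (hy : y ∈ Ioo (x m) (x n))
    (hyx : y ∉ range x) : ∃ i, m ≤ i ∧ i < n ∧ y ∈ Ioo (x i) (x (i + 1)) := by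
  induction n, hmn using Nat.le_induction with
  | base => exact absurd (hy.1.trans hy.2) (lt_irrefl _)
  | succ n hn ih =>
    rcases lt_trichotomy y (x n) with h | h | h
    · obtain ⟨i, h1, h2, h3⟩ := ih ⟨hy.1, h⟩
      exact ⟨i, h1, by omega, h3⟩
    · exact absurd ⟨n, h.symm⟩ hyx
    · exact ⟨n, hn, by omega, h, hy.2⟩

lemma ae_notMem_range (x : ℕ → ℝ) : ∀ᵐ y : ℝ, y ∉ range x :=
  (countable_range x).ae_notMem volume

end partition

/-! ### The two-step mesh and its finite element space -/

section mesh

variable {k : ℕ} {ε α H : ℝ} {N₁ N₂ : ℕ}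

lemma transition_pos (k : ℕ) (hε : 0 < ε) : 0 < transition k ε := Real.rpow_pos_of_pos hε _

lemma transition_lt_one (hk : 2 ≤ k) (hε : 0 < ε) (hε1 : ε < 1) : transition k ε < 1 := by
  have : (2 : ℝ) ≤ k := by exact_mod_cast hk
  exact Real.rpow_lt_one hε.le hε1 (div_pos (by linarith) (by linarith))

namespace IsMesh

lemma fineStep_pos (hM : IsMesh k ε α H N₁ N₂) (hε : 0 < ε) : 0 < fineStep k ε α H :=
  mul_pos (mul_pos hM.α_pos hM.H_pos) (transition_pos k hε)

lemma one_le_N₂ (hM : IsMesh k ε α H N₁ N₂) (hk : 2 ≤ k) (hε : 0 < ε) (hε1 : ε < 1) :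
    1 ≤ N₂ := by
  by_contra! h
  obtain rfl : N₂ = 0 := by omega
  have := hM.coarse
  have := transition_lt_one hk hε hε1
  norm_num at *
  linarith

lemma H_le_one (hM : IsMesh k ε α H N₁ N₂) (hk : 2 ≤ k) (hε : 0 < ε) (hε1 : ε < 1) : H ≤ 1 := by
  have h1 : (1 : ℝ) ≤ N₂ := by exact_mod_cast hM.one_le_N₂ hk hε hε1
  have := hM.coarse
  have := transition_pos k hε
  nlinarith [hM.H_pos]

lemma node_zero : node k ε α H N₁ 0 = 0 := by simp [node]

lemma node_fine_end (hM : IsMesh k ε α H N₁ N₂) : node k ε α H N₁ N₁ = transition k ε := by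
  simp [node, hM.fine]

lemma node_end (hM : IsMesh k ε α H N₁ N₂) (hk : 2 ≤ k) (hε : 0 < ε) (hε1 : ε < 1) :
    node k ε α H N₁ (N₁ + N₂) = 1 := by
  have := hM.one_le_N₂ hk hε hε1
  rw [node, if_neg (by omega)]
  push_cast
  have := hM.coarse
  linarith

lemma node_succ_fine {i : ℕ} (hi : i < N₁) :
    node k ε α H N₁ (i + 1) = node k ε α H N₁ i + fineStep k ε α H := by
  rw [node, node, if_pos (by omega), if_pos (by omega)]
  push_cast
  ring

lemma node_succ_coarse (hM : IsMesh k ε α H N₁ N₂) {i : ℕ} (hi : N₁ ≤ i) :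
    node k ε α H N₁ (i + 1) = node k ε α H N₁ i + H := by
  rcases hi.eq_or_lt with rfl | h
  · rw [hM.node_fine_end, node, if_neg (by omega)]
    push_cast
    ring
  · rw [node, node, if_neg (by omega), if_neg (by omega)]
    push_cast
    ring

lemma strictMono_node (hM : IsMesh k ε α H N₁ N₂) (hε : 0 < ε) :
    StrictMono (node k ε α H N₁) := by
  refine strictMono_nat_of_lt_succ fun i => ?_
  rcases Nat.lt_or_ge i N₁ with h | h
  · rw [node_succ_fine h]
    linarith [hM.fineStep_pos hε]
  · rw [hM.node_succ_coarse h]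
    linarith [hM.H_pos]

lemma node_nonneg (hM : IsMesh k ε α H N₁ N₂) (hε : 0 < ε) (i : ℕ) : 0 ≤ node k ε α H N₁ i := by
  rw [← node_zero (k := k) (ε := ε) (α := α) (H := H) (N₁ := N₁)]
  exact (hM.strictMono_node hε).monotone (Nat.zero_le i)

lemma node_le_one (hM : IsMesh k ε α H N₁ N₂) (hk : 2 ≤ k) (hε : 0 < ε) (hε1 : ε < 1) {i : ℕ}
    (hi : i ≤ N₁ + N₂) : node k ε α H N₁ i ≤ 1 := by
  rw [← hM.node_end hk hε hε1]
  exact (hM.strictMono_node hε).monotone hi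

end IsMesh

namespace MemFE

variable {v w : ℝ → ℝ}

lemma lipI (hv : MemFE k ε α H N₁ N₂ v) (hM : IsMesh k ε α H N₁ N₂) (hk : 2 ≤ k) (hε : 0 < ε)
    (hε1 : ε < 1) : LipI v := by
  have := exists_lipschitz_of_piecewise (v := v) (node k ε α H N₁) (N₁ + N₂) fun i hi => by
    obtain ⟨p, _, hp⟩ := hv.piecewise i hi
    exact ⟨p, hp⟩
  rwa [IsMesh.node_zero, hM.node_end hk hε hε1] at this

lemma sub (hv : MemFE k ε α H N₁ N₂ v) (hw : MemFE k ε α H N₁ N₂ w) :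
    MemFE k ε α H N₁ N₂ (fun x => v x - w x) := by
  refine ⟨hv.continuousOn.sub hw.continuousOn, by rw [hv.right_bc, hw.right_bc, sub_self],
    fun i hi => ?_⟩
  obtain ⟨p, hp, hp'⟩ := hv.piecewise i hi
  obtain ⟨q, hq, hq'⟩ := hw.piecewise i hi
  refine ⟨p - q, (Polynomial.natDegree_sub_le _ _).trans (max_le hp hq), fun x hx => ?_⟩
  rw [hp' x hx, hq' x hx, Polynomial.eval_sub]

/-- The inverse inequality for finite element functions on the coarse part of the mesh. -/
lemma inverse (hv : MemFE k ε α H N₁ N₂ v) (hM : IsMesh k ε α H N₁ N₂) (hk : 2 ≤ k) (hε : 0 < ε)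
    (hε1 : ε < 1) {C : ℝ}
    (hC : ∀ p : ℝ[X], p.natDegree ≤ k → ∀ a l : ℝ, 0 < l →
      l ^ 2 * ∫ x in a..(a + l), p.derivative.eval x ^ 2 ≤ C * ∫ x in a..(a + l), p.eval x ^ 2) :
    H ^ 2 * ∫ x in (transition k ε)..1, deriv v x ^ 2 ≤
      C * ∫ x in (transition k ε)..1, v x ^ 2 := by
  have hL := hv.lipI hM hk hε hε1
  rw [← hM.node_fine_end, ← hM.node_end hk hε hε1]
  have mono := hM.strictMono_node hε
  have key : ∀ n ≤ N₂, H ^ 2 * ∫ x in (node k ε α H N₁ N₁)..(node k ε α H N₁ (N₁ + n)),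
      deriv v x ^ 2 ≤ C * ∫ x in (node k ε α H N₁ N₁)..(node k ε α H N₁ (N₁ + n)), v x ^ 2 := by
    intro n
    induction n with
    | zero => simp
    | succ n ih =>
      intro hn
      have ih' := ih (by omega)
      have l1 := mono.monotone (show N₁ ≤ N₁ + n by omega)
      have l2 := mono.monotone (show N₁ + n ≤ N₁ + n + 1 by omega)
      have l3 := hM.node_le_one hk hε hε1 (show N₁ + n + 1 ≤ N₁ + N₂ by omega)
      have l0 := hM.node_nonneg hε N₁
      have i1 := (hL.bm_deriv.pow 2).ii l0 l1 (l2.trans l3)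
      have i2 := (hL.bm_deriv.pow 2).ii (l0.trans l1) l2 l3
      have j1 := (hL.bm.pow 2).ii l0 l1 (l2.trans l3)
      have j2 := (hL.bm.pow 2).ii (l0.trans l1) l2 l3
      rw [← add_assoc N₁ n 1, ← intervalIntegral.integral_add_adjacent_intervals i1 i2,
        ← intervalIntegral.integral_add_adjacent_intervals j1 j2, mul_add, mul_add]
      refine add_le_add ih' ?_
      obtain ⟨p, hp, hp'⟩ := hv.piecewise (N₁ + n) (by omega)
      have e1 : ∫ x in (node k ε α H N₁ (N₁ + n))..(node k ε α H N₁ (N₁ + n + 1)),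
          deriv v x ^ 2 = ∫ x in (node k ε α H N₁ (N₁ + n))..(node k ε α H N₁ (N₁ + n + 1)),
          p.derivative.eval x ^ 2 := by
        refine integral_congr_Ioo l2 (ae_of_forall_Ioo fun x hx => ?_)
        have : v =ᶠ[nhds x] fun y => p.eval y :=
          Filter.eventually_of_mem (Icc_mem_nhds hx.1 hx.2) hp'
        rw [this.deriv_eq, Polynomial.deriv]
      have e2 : ∫ x in (node k ε α H N₁ (N₁ + n))..(node k ε α H N₁ (N₁ + n + 1)),
          v x ^ 2 = ∫ x in (node k ε α H N₁ (N₁ + n))..(node k ε α H N₁ (N₁ + n + 1)),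
          p.eval x ^ 2 :=
        integral_congr_Ioo l2 (ae_of_forall_Ioo fun x hx => by
          rw [hp' x (Ioo_subset_Icc_self hx)])
      rw [e1, e2, hM.node_succ_coarse (by omega)]
      exact hC p hp _ _ hM.H_pos
  exact key N₂ le_rfl

end MemFE

/-- The global quasi-interpolant, with local error bounds. -/
lemma exists_globalInterp {F : ℕ → ℝ → ℝ} (hF : DerivFam F) (hF1 : F 0 1 = 0)
    (hM : IsMesh k ε α H N₁ N₂) (hk : 2 ≤ k) (hε : 0 < ε) (hε1 : ε < 1) {κ : ℝ} (hκ : 0 ≤ κ)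
    (M m : ℕ → ℝ) (hM0 : ∀ i, 0 ≤ M i) (hm0 : ∀ i, 0 ≤ m i)
    (hb : ∀ i < N₁ + N₂, ∀ s ∈ Icc (node k ε α H N₁ i) (node k ε α H N₁ (i + 1)),
      |F (k + 1) s| ≤ M i + m i * κ ^ (k + 1) * Real.exp (-(κ * s))) :
    ∃ v : ℝ → ℝ, MemFE k ε α H N₁ N₂ v ∧ v 0 = F 0 0 ∧ ∀ i < N₁ + N₂, ∀ l : ℝ,
      node k ε α H N₁ (i + 1) = node k ε α H N₁ i + l →
      ∀ x ∈ Ioo (node k ε α H N₁ i) (node k ε α H N₁ (i + 1)),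
        |F 0 x - v x| ≤ 2 * (M i * l ^ (k + 1) + m i * Real.exp (-(κ * node k ε α H N₁ i))) ∧
        |deriv (fun y => F 0 y - v y) x| ≤ 2 * M i * l ^ k + m i * κ * Real.exp (-(κ * x)) +
          m i * Real.exp (-(κ * node k ε α H N₁ i)) / l := by
  have mono := hM.strictMono_node hε
  have hN := hM.one_le_N₂ hk hε hε1
  have hex := fun i (hi : i < N₁ + N₂) =>
    exists_quasiInterp hF (hM.node_nonneg hε i) (mono (Nat.lt_add_one i))
      (hM.node_le_one hk hε hε1 (i := i + 1) hi) (hM0 i) hκ (by omega : 1 ≤ k) (hm0 i) (hb i hi)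
  choose! p hp using hex
  -- Adjacent pieces fit together because each matches `F 0` at both ends of its cell.
  obtain ⟨v, hv⟩ := exists_glue (node k ε α H N₁) mono p (N₁ + N₂) fun i hi => by
    rw [(hp i (by omega)).2.2.1, (hp (i + 1) hi).2.1]
  have hv0 : v 0 = F 0 0 := by
    have h1 := hv 0 (by omega) (node k ε α H N₁ 0) (left_mem_Icc.2 (mono (Nat.lt_succ_self 0)).le)
    rwa [(hp 0 (by omega)).2.1, IsMesh.node_zero] at h1
  have hv1 : v 1 = 0 := by
    obtain ⟨n, hn⟩ : ∃ n, N₁ + N₂ = n + 1 := ⟨N₁ + N₂ - 1, by omega⟩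
    have h1 := hv n (by omega) (node k ε α H N₁ (n + 1))
      (right_mem_Icc.2 (mono (Nat.lt_succ_self n)).le)
    rwa [(hp n (by omega)).2.2.1, ← hn, hM.node_end hk hε hε1, hF1] at h1
  have hpw : ∀ i < N₁ + N₂, ∃ q : ℝ[X], q.natDegree ≤ k ∧
      ∀ x ∈ Icc (node k ε α H N₁ i) (node k ε α H N₁ (i + 1)), v x = q.eval x :=
    fun i hi => ⟨p i, (hp i hi).1, hv i hi⟩
  have hc : ContinuousOn v (Icc 0 1) := by
    obtain ⟨K, hK⟩ := exists_lipschitz_of_piecewise (v := v) (node k ε α H N₁) (N₁ + N₂)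
      fun i hi => ⟨p i, hv i hi⟩
    rw [IsMesh.node_zero, hM.node_end hk hε hε1] at hK
    exact hK.continuousOn
  refine ⟨v, ⟨hc, hv1, hpw⟩, hv0, fun i hi l hl x hx => ?_⟩
  obtain ⟨-, -, -, h1, h2⟩ := hp i hi
  have e : node k ε α H N₁ (i + 1) - node k ε α H N₁ i = l := by rw [hl]; ring
  rw [e] at h1 h2
  have hx' := Ioo_subset_Icc_self hx
  constructor
  · rw [hv i hi x hx']
    exact h1 x hx'
  · have hx01 : x ∈ Ioo (0 : ℝ) 1 := ⟨(hM.node_nonneg hε i).trans_lt hx.1,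
      hx.2.trans_le (hM.node_le_one hk hε hε1 hi)⟩
    have hve : v =ᶠ[nhds x] fun y => (p i).eval y :=
      Filter.eventually_of_mem (Icc_mem_nhds hx.1 hx.2) (hv i hi)
    have hd : HasDerivAt (fun y => F 0 y - v y) (F 1 x - (p i).derivative.eval x) x :=
      (hF.hasDerivAt 0 hx01).sub (((p i).hasDerivAt x).congr_of_eventuallyEq hve)
    rw [hd.deriv]
    exact h2 x hx'

end mesh

/-! ### Error estimates in the two regimes -/

section error

variable {k : ℕ} {ε α H γ B : ℝ} {N₁ N₂ : ℕ} {b c f u uh v : ℝ → ℝ}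

/-- Reduction of the error estimate to the consistency of an approximation. -/
lemma error_le_of_approx (hM : IsMesh k ε α H N₁ N₂) (hk : 2 ≤ k) (hε : 0 < ε) (hε1 : ε < 1)
    (hγ : 0 < γ) (h : Coef b c B) (hell : VElliptic ε b c γ) (hu : IsSolution ε b c f u)
    (huh : IsFESolution k ε α H N₁ N₂ b c f uh) (hv : MemFE k ε α H N₁ N₂ v) {δ : ℝ} (hδ : 0 ≤ δ)
    (hle : ∀ e, MemFE k ε α H N₁ N₂ e →
      |bilin ε b c (fun x => u x - v x) e| ≤ δ * (epsNorm ε e + |e 0|)) :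
    epsNorm ε (fun x => u x - uh x) ≤
      epsNorm ε (fun x => u x - v x) + (2 / γ + 2 * (2 + 3 * B / γ)) * δ := by
  have hvL := hv.lipI hM hk hε hε1
  have huhL := huh.1.lipI hM hk hε hε1
  have he := hv.sub huh.1
  have heL := he.lipI hM hk hε hε1
  -- Galerkin orthogonality: `a(u - uh, e) = 0` for `e = v - uh`.
  have e1 : bilin ε b c (fun x => v x - uh x) (fun x => v x - uh x) =
      -bilin ε b c (fun x => u x - v x) (fun x => v x - uh x) := by
    rw [bilin_sub h hvL huhL heL, bilin_sub h hu.lipI hvL heL, huh.2 _ he,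
      hu.bilin_eq h heL he.right_bc]
    ring
  have h1 := epsNorm_le_of_bilin_le hε.le hγ h hell heL he.right_bc hδ
    (by rw [e1, abs_neg]; exact hle _ he)
  have h2 := epsNorm_le_add (ε := ε) (w := fun x => u x - uh x) (hu.lipI.sub hvL) heL
    (fun x => by ring)
  linarith [abs_nonneg (v 0 - uh 0)]

lemma fineStep_le (hM : IsMesh k ε α H N₁ N₂) (hε : 0 < ε) {L : ℝ} (hα : α ≤ L) :
    fineStep k ε α H ≤ L * (H * transition k ε) := by
  have h1 := mul_pos hM.H_pos (transition_pos k hε)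
  calc fineStep k ε α H = α * (H * transition k ε) := mul_assoc _ _ _
    _ ≤ _ := mul_le_mul_of_nonneg_right hα h1.le

lemma transition_pow (hk : 2 ≤ k) (hε : 0 < ε) : transition k ε ^ k = ε ^ (k - 1) := by
  have hk0 : (k : ℝ) ≠ 0 := by positivity
  rw [transition, ← Real.rpow_natCast, ← Real.rpow_mul hε.le, div_mul_cancel₀ _ hk0,
    ← Real.rpow_natCast, Nat.cast_sub (by omega), Nat.cast_one]

/-- This is where the exponent `(k-1)/k` matters: `(Hτ)^k = H^k ε^(k-1) ≤ ε^k`. Hence the fine step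
is `O(ε)` in this regime. -/
lemma mul_transition_le (hk : 2 ≤ k) (hε : 0 < ε) (hH : H ^ k ≤ ε) :
    H * transition k ε ≤ ε := by
  refine le_of_pow_le_pow_left₀ (n := k) (by omega) hε.le ?_
  rw [mul_pow, transition_pow hk hε]
  calc H ^ k * ε ^ (k - 1) ≤ ε * ε ^ (k - 1) := by gcongr
    _ = ε ^ k := by rw [← pow_succ']; congr 1; omega

/-- The error estimate for `ε ≤ H ^ k`, by comparison with the reduced problem. -/
lemma exists_error_small (hk : 2 ≤ k) (hb : ContDiffOn ℝ ∞ b (Icc 0 1))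
    (hc : ContDiffOn ℝ ∞ c (Icc 0 1)) (hf : ContDiffOn ℝ ∞ f (Icc 0 1))
    (hb1 : ∀ x ∈ Icc (0 : ℝ) 1, 1 < b x) (hγ : 0 < γ) (α₁ : ℝ) :
    ∃ C, 0 < C ∧ ∀ ε, 0 < ε → ε < 1 → VElliptic ε b c γ → ∀ u, IsSolution ε b c f u →
      ∀ (α H : ℝ) (N₁ N₂ : ℕ), α ≤ α₁ → IsMesh k ε α H N₁ N₂ → ε ≤ H ^ k →
      ∀ uh, IsFESolution k ε α H N₁ N₂ b c f uh →
        epsNorm ε (fun x => u x - uh x) ≤ C * H ^ k := by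
  obtain ⟨B, hco⟩ := exists_coef (LipI.of_contDiffOn (by exact_mod_cast le_top) hb)
    hc.continuousOn hb1
  have hB := hco.one_le
  obtain ⟨S, hS, hS1, hSeq⟩ := exists_reduced hb hc hf hb1
  choose K hK0 hK using hS.bound
  set L := max 1 α₁ with hL
  have hL1 : 1 ≤ L := le_max_left _ _
  have hK1 := hK0 (k + 1)
  set Kc := K 1 + K 2 with hKc
  have hKc0 : 0 < Kc := add_pos (hK0 1) (hK0 2)
  set A := 2 * K (k + 1) * L ^ (k + 1) with hA
  have hA0 : 0 < A := by positivity
  set G := 2 / γ + 2 * (2 + 3 * B / γ) with hG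
  have hG0 : 0 < G := by positivity
  refine ⟨G * Kc + 2 * A + G * (Kc + (1 + 2 * B) * A), by positivity, ?_⟩
  intro ε hε hε1 hell u hu α H N₁ N₂ hα hM hεH uh huh
  have hH0 := hM.H_pos
  have hH1 := hM.H_le_one hk hε hε1
  have hτ1 := transition_lt_one hk hε hε1
  have hτ0 := transition_pos k hε
  have hP : 0 < H ^ k := by positivity
  have hs1 : Real.sqrt ε ≤ 1 := Real.sqrt_le_one.2 hε1.le
  -- `S` has no layer, so `κ = 0` and `m = 0`.
  obtain ⟨v, hv, -, hvb⟩ := exists_globalInterp hS hS1 hM hk hε hε1 (κ := 0) le_rfl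
    (fun _ => K (k + 1)) (fun _ => 0) (fun _ => hK1.le) (fun _ => le_rfl) (fun i hi s hs => by
      have := hK (k + 1) s ⟨(hM.node_nonneg hε i).trans hs.1,
        hs.2.trans (hM.node_le_one hk hε hε1 hi)⟩
      simpa using this)
  have hvL := hv.lipI hM hk hε hε1
  have hcell : ∀ᵐ x : ℝ, x ∈ Ioo (0 : ℝ) 1 → |S 0 x - v x| ≤ A * H ^ k ∧
      |deriv (fun y => S 0 y - v y) x| ≤ A * H ^ k := by
    filter_upwards [ae_notMem_range (node k ε α H N₁)] with x hx hx01
    obtain ⟨i, -, hi, hxi⟩ := exists_cell (x := node k ε α H N₁) (Nat.zero_le (N₁ + N₂))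
      (by rwa [IsMesh.node_zero, hM.node_end hk hε hε1]) hx
    obtain ⟨l, hl, hl0, hlH⟩ : ∃ l, node k ε α H N₁ (i + 1) = node k ε α H N₁ i + l ∧ 0 ≤ l ∧
        l ≤ L * H := by
      rcases Nat.lt_or_ge i N₁ with h | h
      · refine ⟨_, IsMesh.node_succ_fine h, (hM.fineStep_pos hε).le, ?_⟩
        refine (fineStep_le hM hε (hα.trans (le_max_right 1 α₁))).trans ?_
        gcongr
        exact mul_le_of_le_one_right hH0.le hτ1.le
      · exact ⟨_, hM.node_succ_coarse h, hH0.le, le_mul_of_one_le_left hH0.le hL1⟩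
    obtain ⟨h1, h2⟩ := hvb i hi l hl x hxi
    simp only [zero_mul, add_zero, mul_zero, zero_div] at h1 h2
    have e1 : l ^ (k + 1) ≤ L ^ (k + 1) * H ^ k := by
      calc l ^ (k + 1) ≤ (L * H) ^ (k + 1) := by gcongr
        _ = L ^ (k + 1) * (H ^ k * H) := by rw [mul_pow, pow_succ H]
        _ ≤ L ^ (k + 1) * (H ^ k * 1) := by gcongr
        _ = _ := by rw [mul_one]
    have e2 : l ^ k ≤ L ^ (k + 1) * H ^ k := by
      calc l ^ k ≤ (L * H) ^ k := by gcongr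
        _ = L ^ k * H ^ k := mul_pow _ _ _
        _ ≤ L ^ (k + 1) * H ^ k := by
          gcongr
          omega
    constructor
    · refine h1.trans ?_
      calc _ ≤ 2 * (K (k + 1) * (L ^ (k + 1) * H ^ k)) := by gcongr
        _ = _ := by rw [hA]; ring
    · refine h2.trans ?_
      calc _ ≤ 2 * K (k + 1) * (L ^ (k + 1) * H ^ k) := by gcongr
        _ = _ := by rw [hA]; ring
  have hSL := hS.lipI 0
  have hζL := hSL.sub hvL
  have hAH : 0 ≤ A * H ^ k := by positivity
  have hζ0 : norm0 (fun x => S 0 x - v x) ≤ A * H ^ k :=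
    norm0_le hζL.bm hAH (hcell.mono fun x hx h => (hx h).1)
  have hζ1 : semi1 (fun x => S 0 x - v x) ≤ A * H ^ k :=
    norm0_le hζL.bm_deriv hAH (hcell.mono fun x hx h => (hx h).2)
  have hSc := fun (w : ℝ → ℝ) (hw : LipI w) (hw1 : w 1 = 0) =>
    abs_bilin_sub_reduced_le (K := Kc) hε.le hu hco hS hSeq
    (fun x hx => (hK 1 x hx).trans (by linarith [hK0 2]))
    (fun x hx => (hK 2 x hx).trans (by linarith [hK0 1])) hw hw1
  have hd1 : (fun x => u x - S 0 x) 1 = 0 := by simp [hu.right_bc, hS1]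
  -- Coercivity applied to `u - S` itself, with its own consistency bound as right-hand side.
  have h1 : epsNorm ε (fun x => u x - S 0 x) ≤ G * (Kc * ε) := by
    have := epsNorm_le_of_bilin_le hε.le hγ hco hell (hu.lipI.sub hSL) hd1
      (by positivity) (hSc _ (hu.lipI.sub hSL) hd1)
    exact (le_add_of_nonneg_right (abs_nonneg _)).trans this
  have h2 : epsNorm ε (fun x => S 0 x - v x) ≤ 2 * (A * H ^ k) := by
    have : Real.sqrt ε * semi1 (fun x => S 0 x - v x) ≤ 1 * (A * H ^ k) :=
      mul_le_mul hs1 hζ1 (semi1_nonneg _) zero_le_one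
    unfold epsNorm
    linarith
  have h3 : epsNorm ε (fun x => u x - v x) ≤ G * (Kc * ε) + 2 * (A * H ^ k) :=
    (epsNorm_le_add (hu.lipI.sub hSL) hζL fun x => by ring).trans (add_le_add h1 h2)
  have h4 := error_le_of_approx hM hk hε hε1 hγ hco hell hu huh hv
    (δ := Kc * ε + (1 + 2 * B) * (A * H ^ k)) (by positivity) (fun e he => by
      have heL := he.lipI hM hk hε hε1
      have e1 : bilin ε b c (fun x => u x - v x) e = bilin ε b c (fun x => u x - S 0 x) e +
          bilin ε b c (fun x => S 0 x - v x) e := by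
        rw [bilin_sub hco hu.lipI hvL heL, bilin_sub hco hu.lipI hSL heL,
          bilin_sub hco hSL hvL heL]
        ring
      rw [e1]
      refine (abs_add_le _ _).trans ?_
      have e2 := hSc e heL he.right_bc
      have e3 := abs_bilin_le hε.le hco hζL heL
      have e4 : ε * semi1 e ≤ epsNorm ε e := by
        refine le_trans ?_ (sqrt_mul_semi1_le_epsNorm ε e)
        refine mul_le_mul_of_nonneg_right ?_ (semi1_nonneg _)
        exact Real.le_sqrt_of_sq_le (by nlinarith)
      have e5 := norm0_le_epsNorm ε e
      have e6 : ε * (semi1 (fun x => S 0 x - v x) * semi1 e) ≤ (A * H ^ k) * epsNorm ε e := by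
        calc _ = semi1 (fun x => S 0 x - v x) * (ε * semi1 e) := by ring
          _ ≤ _ := mul_le_mul hζ1 e4 (mul_nonneg hε.le (semi1_nonneg _)) hAH
      have e7 : B * (semi1 (fun x => S 0 x - v x) * norm0 e) ≤ B * ((A * H ^ k) * epsNorm ε e) :=
        mul_le_mul_of_nonneg_left (mul_le_mul hζ1 e5 (norm0_nonneg _) hAH) (by linarith)
      have e8 : B * (norm0 (fun x => S 0 x - v x) * norm0 e) ≤ B * ((A * H ^ k) * epsNorm ε e) :=
        mul_le_mul_of_nonneg_left (mul_le_mul hζ0 e5 (norm0_nonneg _) hAH) (by linarith)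
      have e9 : 0 ≤ (1 + 2 * B) * (A * H ^ k) * |e 0| :=
        mul_nonneg (mul_nonneg (by linarith) hAH) (abs_nonneg _)
      linarith)
  calc _ ≤ _ := h4
    _ ≤ G * (Kc * ε) + 2 * (A * H ^ k) + G * (Kc * ε + (1 + 2 * B) * (A * H ^ k)) := by
      linarith
    _ ≤ G * (Kc * H ^ k) + 2 * (A * H ^ k) + G * (Kc * H ^ k + (1 + 2 * B) * (A * H ^ k)) := by
      gcongr
    _ = _ := by ring

lemma integral_exp_sq_le (hε : 0 < ε) (a d : ℝ) :
    ∫ x in a..d, Real.exp (-(ε⁻¹ * x)) ^ 2 ≤ ε * Real.exp (-(ε⁻¹ * a)) ^ 2 := by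
  have hd : ∀ x ∈ uIcc a d, HasDerivAt (fun x => -(ε / 2) * Real.exp (-(ε⁻¹ * x)) ^ 2)
      (Real.exp (-(ε⁻¹ * x)) ^ 2) x := fun x _ => by
    have : HasDerivAt (fun x => -(ε / 2) * Real.exp (-(ε⁻¹ * x)) ^ 2)
        (-(ε / 2) * (((2 : ℕ) : ℝ) * Real.exp (-(ε⁻¹ * x)) ^ (2 - 1) *
          (Real.exp (-(ε⁻¹ * x)) * (-(ε⁻¹ * 1))))) x :=
      (((((hasDerivAt_id x).const_mul ε⁻¹).neg).exp).pow 2).const_mul (-(ε / 2))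
    refine this.congr_deriv ?_
    norm_num
    field_simp
  rw [intervalIntegral.integral_eq_sub_of_hasDerivAt hd
    ((by fun_prop : Continuous fun x => Real.exp (-(ε⁻¹ * x)) ^ 2).intervalIntegrable _ _)]
  have h1 : 0 ≤ ε * Real.exp (-(ε⁻¹ * d)) ^ 2 := by positivity
  have h2 : 0 ≤ ε * Real.exp (-(ε⁻¹ * a)) ^ 2 := by positivity
  linarith

/-- The `L²` norm of the layer gains `√ε`, because `∫ e^(-2x/ε)` from `a` is at most `ε e^(-2a/ε)`.
-/
lemma sqrt_integral_layer_le {g : ℝ → ℝ} (hg : BM g) {a d A D : ℝ} (ha : 0 ≤ a) (had : a ≤ d)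
    (hd : d ≤ 1) (hε : 0 < ε) (hA : 0 ≤ A) (hD : 0 ≤ D)
    (h : ∀ᵐ x : ℝ, x ∈ Ioo a d → |g x| ≤ A + D * Real.exp (-(ε⁻¹ * x))) :
    Real.sqrt (∫ x in a..d, g x ^ 2) ≤
      2 * A + 2 * D * (Real.sqrt ε * Real.exp (-(ε⁻¹ * a))) := by
  have hE : Continuous fun x => Real.exp (-(ε⁻¹ * x)) ^ 2 := by fun_prop
  rw [Real.sqrt_le_iff]
  refine ⟨by positivity, ?_⟩
  calc ∫ x in a..d, g x ^ 2 ≤ ∫ x in a..d, (2 * A ^ 2 + 2 * D ^ 2 * Real.exp (-(ε⁻¹ * x)) ^ 2) := by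
        refine integral_le_of_ae_Ioo had ((hg.pow 2).ii ha had hd)
          ((by fun_prop : Continuous _).intervalIntegrable _ _) ?_
        filter_upwards [h] with x hx hx'
        have h1 := hx hx'
        rw [← sq_abs]
        have h2 := pow_le_pow_left₀ (abs_nonneg _) h1 2
        nlinarith [sq_nonneg (A - D * Real.exp (-(ε⁻¹ * x)))]
    _ = (d - a) * (2 * A ^ 2) + 2 * D ^ 2 * ∫ x in a..d, Real.exp (-(ε⁻¹ * x)) ^ 2 := by
        rw [intervalIntegral.integral_add (by simp)
          ((hE.intervalIntegrable _ _).const_mul _), intervalIntegral.integral_const,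
          intervalIntegral.integral_const_mul, smul_eq_mul]
    _ ≤ 1 * (2 * A ^ 2) + 2 * D ^ 2 * (ε * Real.exp (-(ε⁻¹ * a)) ^ 2) := by
        have := integral_exp_sq_le hε a d
        gcongr
        linarith
    _ ≤ _ := by
        have h1 : (Real.sqrt ε * Real.exp (-(ε⁻¹ * a))) ^ 2 = ε * Real.exp (-(ε⁻¹ * a)) ^ 2 := by
          rw [mul_pow, Real.sq_sqrt hε.le]
        rw [← h1]
        set y := Real.sqrt ε * Real.exp (-(ε⁻¹ * a))
        have hy : 0 ≤ A * (D * y) := by positivity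
        nlinarith [sq_nonneg A, sq_nonneg (D * y)]

/-- The approximation of the solution for `H ^ k ≤ ε`. -/
lemma exists_approx_large (hk : 2 ≤ k) (hb : ContDiffOn ℝ ∞ b (Icc 0 1))
    (hc : ContDiffOn ℝ ∞ c (Icc 0 1)) (hf : ContDiffOn ℝ ∞ f (Icc 0 1))
    (hb1 : ∀ x ∈ Icc (0 : ℝ) 1, 1 < b x) (hγ : 0 < γ) (α₁ μ : ℝ) :
    ∃ Q, 0 < Q ∧ ∀ ε, 0 < ε → ε < 1 → VElliptic ε b c γ → ∀ u, IsSolution ε b c f u →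
      ∀ (α H : ℝ) (N₁ N₂ : ℕ), α ≤ α₁ → IsMesh k ε α H N₁ N₂ → H ^ k ≤ ε →
      LayerSmall k ε H μ → ∃ v, MemFE k ε α H N₁ N₂ v ∧ v 0 = u 0 ∧
        Real.sqrt (∫ x in (0 : ℝ)..transition k ε, (u x - v x) ^ 2) ≤
          Q * H ^ k * Real.sqrt ε ∧
        Real.sqrt ε * Real.sqrt (∫ x in (0 : ℝ)..transition k ε,
          deriv (fun y => u y - v y) x ^ 2) ≤ Q * H ^ k ∧
        Real.sqrt (∫ x in transition k ε..1, (u x - v x) ^ 2) ≤ Q * H ^ (k + 1) ∧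
        Real.sqrt ε * Real.sqrt (∫ x in transition k ε..1,
          deriv (fun y => u y - v y) x ^ 2) ≤ Q * H ^ k := by
  obtain ⟨C, hC, hCb⟩ := exists_layer_bound hb hc hf hb1 hγ (k + 1)
  set L := max 1 α₁ with hL
  have hL1 : 1 ≤ L := le_max_left _ _
  set c1 := 2 * C * Real.exp L with hc1
  have hc1p : 0 < c1 := by positivity
  have hμ0 := abs_nonneg μ
  refine ⟨4 * c1 * L ^ (k + 1) + 2 * C * (2 + 2 * |μ|), by positivity, ?_⟩
  set Q := 4 * c1 * L ^ (k + 1) + 2 * C * (2 + 2 * |μ|) with hQ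
  intro ε hε hε1 hell u hu α H N₁ N₂ hα hM hεH hsmall
  have hH0 := hM.H_pos
  have hH1 := hM.H_le_one hk hε hε1
  set τ := transition k ε with hτ
  have hτ1 : τ < 1 := transition_lt_one hk hε hε1
  have hτ0 : 0 < τ := transition_pos k hε
  have hP : 0 < H ^ k := by positivity
  have hκ1 : 1 ≤ ε⁻¹ := (one_le_inv₀ hε).2 hε1.le
  have hs0 : 0 < Real.sqrt ε := Real.sqrt_pos.2 hε
  have hss : Real.sqrt ε * Real.sqrt ε = ε := Real.mul_self_sqrt hε.le
  have hs1 : Real.sqrt ε ≤ 1 := Real.sqrt_le_one.2 hε1.le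
  set h := fineStep k ε α H with hh
  have hh0 : 0 < h := hM.fineStep_pos hε
  have hhL : h ≤ L * (H * τ) := fineStep_le hM hε (hα.trans (le_max_right 1 α₁))
  have hhε : h ≤ L * ε := hhL.trans (by
    have := mul_transition_le hk hε hεH
    gcongr)
  have hhκ : h * ε⁻¹ ≤ L := by
    rw [← div_eq_mul_inv, div_le_iff₀ hε]
    exact hhε
  -- By `τ^k = ε^(k-1)`, the factor `ε^(-k)` of the high derivative costs only `ε⁻¹` after
  -- multiplication by `h^k`.
  have hhk : h ^ k * ε⁻¹ ^ k ≤ L ^ k * H ^ k * ε⁻¹ := by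
    have h1 : h ^ k ≤ L ^ k * (H ^ k * ε ^ (k - 1)) := by
      rw [← transition_pow hk hε, ← mul_pow, ← mul_pow]
      gcongr
    have h2 : ε ^ (k - 1) * ε⁻¹ ^ k = ε⁻¹ := by
      obtain ⟨m, rfl⟩ : ∃ m, k = m + 1 := ⟨k - 1, by omega⟩
      rw [Nat.add_sub_cancel, pow_succ, ← mul_assoc, ← mul_pow, mul_inv_cancel₀ hε.ne', one_pow,
        one_mul]
    calc h ^ k * ε⁻¹ ^ k ≤ L ^ k * (H ^ k * ε ^ (k - 1)) * ε⁻¹ ^ k := by gcongr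
      _ = L ^ k * H ^ k * (ε ^ (k - 1) * ε⁻¹ ^ k) := by ring
      _ = _ := by rw [h2]
  have hhk1 : h ^ (k + 1) * ε⁻¹ ^ k ≤ L ^ (k + 1) * H ^ k := by
    calc h ^ (k + 1) * ε⁻¹ ^ k = h * (h ^ k * ε⁻¹ ^ k) := by ring
      _ ≤ h * (L ^ k * H ^ k * ε⁻¹) := by gcongr
      _ = (h * ε⁻¹) * (L ^ k * H ^ k) := by ring
      _ ≤ L * (L ^ k * H ^ k) := by gcongr
      _ = _ := by ring
  have hlay : ε * Real.exp (-(ε⁻¹ * τ)) ≤ |μ| * H ^ (k + 1) := by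
    have h1 : ε * Real.exp (-(τ / ε)) ≤ μ * H ^ (k + 1) := hsmall
    rw [div_eq_inv_mul] at h1
    refine h1.trans ?_
    gcongr
    exact le_abs_self μ
  have hfam := DerivFam.of_contDiffOn (hu.contDiffOn_infty hε hb hc hf)
  have hbd := hCb ε hε hε1.le hell u hu (k + 1) le_rfl
  set x := node k ε α H N₁ with hx
  have hxmono : StrictMono x := hM.strictMono_node hε
  have hεκ : ε * ε⁻¹ ^ (k + 1) = ε⁻¹ ^ k := by
    rw [pow_succ]; field_simp
  obtain ⟨v, hv, hv0, hvb⟩ := exists_globalInterp hfam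
    (by simp [hu.right_bc]) hM hk hε hε1 (κ := ε⁻¹) (by positivity)
    -- On fine cells the layer is absorbed into `M` with its largest value, attained at the left
    -- node. On coarse cells it is kept apart with `m = C ε`, for `ε ε^(-(k+1)) = ε^(-k)`.
    (fun i => if i < N₁ then C * (1 + ε⁻¹ ^ k * Real.exp (-(ε⁻¹ * x i))) else C)
    (fun i => if i < N₁ then 0 else C * ε)
    (fun i => by split_ifs <;> positivity) (fun i => by split_ifs <;> positivity)
    (fun i hi s hs => by
      have h1 := hbd s ⟨(hM.node_nonneg hε i).trans hs.1,
        hs.2.trans (hM.node_le_one hk hε hε1 hi)⟩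
      rw [hεκ] at h1
      refine h1.trans ?_
      split_ifs with hi'
      · rw [zero_mul, zero_mul, add_zero]
        gcongr
        exact hs.1
      · rw [mul_assoc C, hεκ]
        linarith)
  simp only [iteratedDerivWithin_zero] at hv0 hvb
  have hvL := hv.lipI hM hk hε hε1
  have hηL := hu.lipI.sub hvL
  have hfine : ∀ᵐ y : ℝ, y ∈ Ioo (0 : ℝ) τ →
      |u y - v y| ≤ c1 * h ^ (k + 1) + c1 * h ^ (k + 1) * ε⁻¹ ^ k * Real.exp (-(ε⁻¹ * y)) ∧
      |deriv (fun y => u y - v y) y| ≤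
        c1 * h ^ k + c1 * h ^ k * ε⁻¹ ^ k * Real.exp (-(ε⁻¹ * y)) := by
    filter_upwards [ae_notMem_range x] with y hy hy01
    obtain ⟨i, -, hi, hyi⟩ := exists_cell (x := x) (Nat.zero_le N₁)
      (by rwa [hx, IsMesh.node_zero, hM.node_fine_end]) hy
    have hstep : x (i + 1) = x i + h := IsMesh.node_succ_fine hi
    obtain ⟨h1, h2⟩ := hvb i (by omega) h hstep y hyi
    simp only [if_pos hi, zero_mul, add_zero, zero_div] at h1 h2
    -- Since `h ≤ L ε`, the exponential varies over a fine cell by a factor of at most `e^L`.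
    have hexp : Real.exp (-(ε⁻¹ * x i)) ≤ Real.exp L * Real.exp (-(ε⁻¹ * y)) := by
      rw [← Real.exp_add]
      apply Real.exp_le_exp.2
      have h3 : ε⁻¹ * y ≤ ε⁻¹ * (x i + h) := by
        rw [← hstep]
        exact mul_le_mul_of_nonneg_left hyi.2.le (by positivity)
      linarith
    have hfac : C * (1 + ε⁻¹ ^ k * Real.exp (-(ε⁻¹ * x i))) ≤
        C * Real.exp L * (1 + ε⁻¹ ^ k * Real.exp (-(ε⁻¹ * y))) := by
      have hL' : 1 ≤ Real.exp L := Real.one_le_exp (by linarith)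
      calc _ ≤ C * (Real.exp L + ε⁻¹ ^ k * (Real.exp L * Real.exp (-(ε⁻¹ * y)))) := by gcongr
        _ = _ := by ring
    constructor
    · refine h1.trans ?_
      calc _ ≤ 2 * (C * Real.exp L * (1 + ε⁻¹ ^ k * Real.exp (-(ε⁻¹ * y))) * h ^ (k + 1)) := by
            gcongr
        _ = _ := by rw [hc1]; ring
    · refine h2.trans ?_
      calc _ ≤ 2 * (C * Real.exp L * (1 + ε⁻¹ ^ k * Real.exp (-(ε⁻¹ * y)))) * h ^ k := by
            gcongr
        _ = _ := by rw [hc1]; ring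
  have hcoarse : ∀ᵐ y : ℝ, y ∈ Ioo τ 1 →
      |u y - v y| ≤ 2 * C * (1 + |μ|) * H ^ (k + 1) ∧
      |deriv (fun y => u y - v y) y| ≤ C * (2 + |μ|) * H ^ k + C * Real.exp (-(ε⁻¹ * y)) := by
    filter_upwards [ae_notMem_range x] with y hy hy01
    obtain ⟨i, hi1, hi, hyi⟩ := exists_cell (x := x) (Nat.le_add_right N₁ N₂)
      (by rwa [hx, hM.node_fine_end, hM.node_end hk hε hε1]) hy
    have hxi : τ ≤ x i := by
      rw [hτ, ← hM.node_fine_end]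
      exact hxmono.monotone hi1
    obtain ⟨h1, h2⟩ := hvb i hi H (hM.node_succ_coarse hi1) y hyi
    simp only [if_neg (not_lt.2 hi1)] at h1 h2
    -- Beyond `τ` the layer is no larger than at `τ`, where it is small by hypothesis.
    have h3 : C * ε * Real.exp (-(ε⁻¹ * x i)) ≤ C * (|μ| * H ^ (k + 1)) := by
      rw [mul_assoc]
      refine mul_le_mul_of_nonneg_left (le_trans ?_ hlay) hC.le
      gcongr
    constructor
    · refine h1.trans ?_
      linarith
    · have h4 : C * ε * Real.exp (-(ε⁻¹ * x i)) / H ≤ C * (|μ| * H ^ k) := by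
        rw [div_le_iff₀ hH0]
        refine h3.trans (le_of_eq ?_)
        ring
      have h5 : C * ε * ε⁻¹ * Real.exp (-(ε⁻¹ * y)) = C * Real.exp (-(ε⁻¹ * y)) := by
        rw [mul_assoc C, mul_inv_cancel₀ hε.ne', mul_one]
      rw [h5] at h2
      refine h2.trans ?_
      linarith
  -- Through this inequality the smooth part of the fine-mesh error is absorbed into the layer part.
  have hκs : 1 ≤ ε⁻¹ ^ k * Real.sqrt ε := by
    have h1 : ε⁻¹ ≤ ε⁻¹ ^ k := le_self_pow₀ hκ1 (by omega)
    have h2 : 1 ≤ ε⁻¹ * Real.sqrt ε := by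
      rw [inv_mul_eq_div, one_le_div hε]
      calc ε = Real.sqrt ε * Real.sqrt ε := hss.symm
        _ ≤ 1 * Real.sqrt ε := by gcongr
        _ = _ := one_mul _
    exact h2.trans (by gcongr)
  have hfineS : ∀ D : ℝ, 0 ≤ D → ∀ g : ℝ → ℝ, BM g →
      (∀ᵐ y : ℝ, y ∈ Ioo (0 : ℝ) τ → |g y| ≤ D + D * ε⁻¹ ^ k * Real.exp (-(ε⁻¹ * y))) →
      Real.sqrt (∫ y in (0 : ℝ)..τ, g y ^ 2) ≤ 4 * (D * ε⁻¹ ^ k) * Real.sqrt ε := by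
    intro D hD g hg hgb
    have h1 := sqrt_integral_layer_le hg le_rfl hτ0.le hτ1.le hε hD (by positivity) hgb
    simp only [mul_zero, neg_zero, Real.exp_zero, mul_one] at h1
    refine h1.trans ?_
    have h2 : D * 1 ≤ D * (ε⁻¹ ^ k * Real.sqrt ε) := by gcongr
    linarith
  have hLk : L ^ k ≤ L ^ (k + 1) := pow_le_pow_right₀ hL1 (by omega)
  have hQ1 : 4 * c1 * L ^ (k + 1) ≤ Q := le_add_of_nonneg_right (by positivity)
  have hQ2 : 2 * C * (2 + 2 * |μ|) ≤ Q := le_add_of_nonneg_left (by positivity)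
  refine ⟨v, hv, hv0, ?_, ?_, ?_, ?_⟩
  · refine (hfineS (c1 * h ^ (k + 1)) (by positivity) _ hηL.bm
      (hfine.mono fun y hy h' => (hy h').1)).trans ?_
    refine mul_le_mul_of_nonneg_right ?_ hs0.le
    calc 4 * (c1 * h ^ (k + 1) * ε⁻¹ ^ k) = 4 * c1 * (h ^ (k + 1) * ε⁻¹ ^ k) := by ring
      _ ≤ 4 * c1 * (L ^ (k + 1) * H ^ k) := by gcongr
      _ = 4 * c1 * L ^ (k + 1) * H ^ k := by ring
      _ ≤ Q * H ^ k := by gcongr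
  · have h1 := hfineS (c1 * h ^ k) (by positivity) _ hηL.bm_deriv
      (hfine.mono fun y hy h' => (hy h').2)
    calc _ ≤ Real.sqrt ε * (4 * (c1 * h ^ k * ε⁻¹ ^ k) * Real.sqrt ε) := by gcongr
      _ = 4 * c1 * (h ^ k * ε⁻¹ ^ k) * (Real.sqrt ε * Real.sqrt ε) := by ring
      _ ≤ 4 * c1 * (L ^ k * H ^ k * ε⁻¹) * (Real.sqrt ε * Real.sqrt ε) := by gcongr
      _ = 4 * c1 * L ^ k * H ^ k := by rw [hss]; field_simp
      _ ≤ 4 * c1 * L ^ (k + 1) * H ^ k := by gcongr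
      _ ≤ Q * H ^ k := by gcongr
  · refine (sqrt_integral_sq_le hηL.bm hτ0.le hτ1.le le_rfl (by positivity)
      (hcoarse.mono fun y hy h' => (hy h').1)).trans ?_
    gcongr
    refine le_trans ?_ hQ2
    gcongr
    · norm_num
    · linarith
  · have h1 := sqrt_integral_layer_le hηL.bm_deriv hτ0.le hτ1.le le_rfl hε
      (by positivity : 0 ≤ C * (2 + |μ|) * H ^ k) hC.le (hcoarse.mono fun y hy h' => (hy h').2)
    have h2 : H ^ (k + 1) ≤ H ^ k := pow_le_pow_of_le_one hH0.le hH1 (by omega)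
    calc _ ≤ Real.sqrt ε * (2 * (C * (2 + |μ|) * H ^ k) +
          2 * C * (Real.sqrt ε * Real.exp (-(ε⁻¹ * τ)))) := by gcongr
      _ = Real.sqrt ε * (2 * (C * (2 + |μ|) * H ^ k)) +
          2 * C * ((Real.sqrt ε * Real.sqrt ε) * Real.exp (-(ε⁻¹ * τ))) := by ring
      _ ≤ 1 * (2 * (C * (2 + |μ|) * H ^ k)) + 2 * C * (|μ| * H ^ k) := by
        rw [hss]
        refine add_le_add (mul_le_mul_of_nonneg_right hs1 (by positivity))
          (mul_le_mul_of_nonneg_left (hlay.trans ?_) (by positivity))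
        gcongr
      _ = 2 * C * (2 + 2 * |μ|) * H ^ k := by ring
      _ ≤ Q * H ^ k := by gcongr

/-- The error estimate for `H ^ k ≤ ε`. -/
lemma exists_error_large (hk : 2 ≤ k) (hb : ContDiffOn ℝ ∞ b (Icc 0 1))
    (hc : ContDiffOn ℝ ∞ c (Icc 0 1)) (hf : ContDiffOn ℝ ∞ f (Icc 0 1))
    (hb1 : ∀ x ∈ Icc (0 : ℝ) 1, 1 < b x) (hγ : 0 < γ) (α₁ μ : ℝ) :
    ∃ C, 0 < C ∧ ∀ ε, 0 < ε → ε < 1 → VElliptic ε b c γ → ∀ u, IsSolution ε b c f u →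
      ∀ (α H : ℝ) (N₁ N₂ : ℕ), α ≤ α₁ → IsMesh k ε α H N₁ N₂ → H ^ k ≤ ε →
      LayerSmall k ε H μ → ∀ uh, IsFESolution k ε α H N₁ N₂ b c f uh →
        epsNorm ε (fun x => u x - uh x) ≤ C * H ^ k := by
  obtain ⟨B, hco⟩ := exists_coef (LipI.of_contDiffOn (by exact_mod_cast le_top) hb)
    hc.continuousOn hb1
  have hB := hco.one_le
  obtain ⟨Q, hQ, happ⟩ := exists_approx_large hk hb hc hf hb1 hγ α₁ μ
  obtain ⟨I, hI, hinv⟩ := exists_inverse k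
  set G := 2 / γ + 2 * (2 + 3 * B / γ) with hG
  have hG0 : 0 < G := by positivity
  set R := Q * (2 + (B + B * Real.sqrt I) + 4 * B) with hR
  have hR0 : 0 < R := by positivity
  refine ⟨4 * Q + G * R, by positivity, ?_⟩
  intro ε hε hε1 hell u hu α H N₁ N₂ hα hM hεH hsmall uh huh
  obtain ⟨v, hv, hv0, f0, f1, c0, c1⟩ := happ ε hε hε1 hell u hu α H N₁ N₂ hα hM hεH hsmall
  have hH0 := hM.H_pos
  have hH1 := hM.H_le_one hk hε hε1
  have hτ1 := transition_lt_one hk hε hε1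
  have hτ0 := transition_pos k hε
  set τ := transition k ε
  have hP : 0 < H ^ k := by positivity
  have hs1 : Real.sqrt ε ≤ 1 := Real.sqrt_le_one.2 hε1.le
  have hs0 := Real.sqrt_nonneg ε
  have hss : Real.sqrt ε * Real.sqrt ε = ε := Real.mul_self_sqrt hε.le
  have hvL := hv.lipI hM hk hε hε1
  have hηL := hu.lipI.sub hvL
  set η : ℝ → ℝ := fun x => u x - v x with hη
  have split : ∀ g : ℝ → ℝ, BM g → norm0 g ≤ Real.sqrt (∫ x in (0 : ℝ)..τ, g x ^ 2) +
      Real.sqrt (∫ x in τ..1, g x ^ 2) := fun g hg => by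
    rw [norm0, ← intervalIntegral.integral_add_adjacent_intervals
      ((hg.pow 2).ii le_rfl hτ0.le hτ1.le) ((hg.pow 2).ii hτ0.le hτ1.le le_rfl)]
    refine Real.sqrt_le_iff.2 ⟨by positivity, ?_⟩
    have h1 := Real.sq_sqrt (intervalIntegral.integral_nonneg hτ0.le
      fun x _ => sq_nonneg (g x) : 0 ≤ ∫ x in (0 : ℝ)..τ, g x ^ 2)
    have h2 := Real.sq_sqrt (intervalIntegral.integral_nonneg hτ1.le
      fun x _ => sq_nonneg (g x) : 0 ≤ ∫ x in τ..1, g x ^ 2)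
    have h3 := mul_nonneg (Real.sqrt_nonneg (∫ x in (0 : ℝ)..τ, g x ^ 2))
      (Real.sqrt_nonneg (∫ x in τ..1, g x ^ 2))
    linarith [add_sq (Real.sqrt (∫ x in (0 : ℝ)..τ, g x ^ 2)) (Real.sqrt (∫ x in τ..1, g x ^ 2))]
  have hn0 : norm0 η ≤ 2 * Q * H ^ k := by
    have h1 : Q * H ^ k * Real.sqrt ε ≤ Q * H ^ k * 1 := by gcongr
    have h2 : Q * H ^ (k + 1) ≤ Q * H ^ k :=
      mul_le_mul_of_nonneg_left (pow_le_pow_of_le_one hH0.le hH1 (by omega)) hQ.le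
    linarith [split η hηL.bm]
  have hn1 : Real.sqrt ε * semi1 η ≤ 2 * Q * H ^ k := by
    have := mul_le_mul_of_nonneg_left (split (deriv η) hηL.bm_deriv) hs0
    rw [mul_add] at this
    refine this.trans ?_
    linarith
  have hηN : epsNorm ε η ≤ 4 * Q * H ^ k := by
    unfold epsNorm
    linarith
  have main := error_le_of_approx hM hk hε hε1 hγ hco hell hu huh hv (δ := R * H ^ k)
    (by positivity) (fun e he => by
      have heL := he.lipI hM hk hε hε1
      have hN0 := epsNorm_nonneg ε e
      have e0 := norm0_le_epsNorm ε e
      have e1 := sqrt_mul_semi1_le_epsNorm ε e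
      have t0 := abs_bilin_le_of_left_zero hε.le hco hηL heL (by simp [hη, hv0]) he.right_bc
      have hbe : BM (fun x => b x * deriv e x) := hco.lip.bm.mul heL.bm_deriv
      have hbs : ∀ a d, 0 ≤ a → a ≤ d → d ≤ 1 → Real.sqrt (∫ x in a..d, (b x * deriv e x) ^ 2) ≤
          B * Real.sqrt (∫ x in a..d, deriv e x ^ 2) := by
        intro a d ha had hd
        rw [Real.sqrt_le_iff]
        refine ⟨by positivity, ?_⟩
        rw [mul_pow, Real.sq_sqrt (intervalIntegral.integral_nonneg had fun _ _ => sq_nonneg _),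
          ← intervalIntegral.integral_const_mul]
        refine integral_le_of_ae_Ioo had ((hbe.pow 2).ii ha had hd)
          (((heL.bm_deriv.pow 2).ii ha had hd).const_mul _) (ae_of_forall_Ioo fun x hx => ?_)
        rw [mul_pow]
        refine mul_le_mul_of_nonneg_right ?_ (sq_nonneg _)
        exact sq_le_sq' (by linarith [(abs_le.1 (hco.b_le x ⟨ha.trans hx.1.le,
          hx.2.le.trans hd⟩)).1]) (abs_le.1 (hco.b_le x ⟨ha.trans hx.1.le, hx.2.le.trans hd⟩)).2
      have sub_le : ∀ g : ℝ → ℝ, BM g → ∀ a d, 0 ≤ a → a ≤ d → d ≤ 1 →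
          Real.sqrt (∫ x in a..d, g x ^ 2) ≤ norm0 g := fun g hg a d ha had hd =>
        Real.sqrt_le_sqrt (intervalIntegral.integral_mono_interval ha had hd
          (Filter.Eventually.of_forall fun y => sq_nonneg _) (hg.pow 2).ii01)
      -- The factor `√ε` of the fine-mesh error completes `|e|₁` to a part of the `ε`-norm.
      have t1 : |∫ x in (0 : ℝ)..τ, η x * (b x * deriv e x)| ≤ Q * H ^ k * (B * epsNorm ε e) := by
        refine (abs_integral_mul_le hηL.bm hbe le_rfl hτ0.le hτ1.le).trans ?_
        calc _ ≤ (Q * H ^ k * Real.sqrt ε) * (B * semi1 e) := by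
              refine mul_le_mul f0 ((hbs 0 τ le_rfl hτ0.le hτ1.le).trans ?_) (Real.sqrt_nonneg _)
                (by positivity)
              exact mul_le_mul_of_nonneg_left
                (sub_le _ heL.bm_deriv 0 τ le_rfl hτ0.le hτ1.le) (by linarith)
          _ = Q * H ^ k * (B * (Real.sqrt ε * semi1 e)) := by ring
          _ ≤ _ := by gcongr
      have t2 : H * Real.sqrt (∫ x in τ..1, deriv e x ^ 2) ≤ Real.sqrt I * epsNorm ε e := by
        have := Real.sqrt_le_sqrt (he.inverse hM hk hε hε1 hinv)
        rw [Real.sqrt_mul (sq_nonneg H), Real.sqrt_mul hI, Real.sqrt_sq hH0.le] at this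
        refine this.trans ?_
        gcongr
        exact (sub_le _ heL.bm τ 1 hτ0.le hτ1.le le_rfl).trans e0
      -- The additional power of `H` in the coarse error compensates the loss `H⁻¹` of the inverse
      -- inequality.
      have t3 : |∫ x in τ..1, η x * (b x * deriv e x)| ≤
          Q * H ^ k * (B * (Real.sqrt I * epsNorm ε e)) := by
        refine (abs_integral_mul_le hηL.bm hbe hτ0.le hτ1.le le_rfl).trans ?_
        calc _ ≤ (Q * H ^ (k + 1)) * (B * Real.sqrt (∫ x in τ..1, deriv e x ^ 2)) :=
              mul_le_mul c0 (hbs τ 1 hτ0.le hτ1.le le_rfl) (Real.sqrt_nonneg _) (by positivity)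
          _ = Q * H ^ k * (B * (H * Real.sqrt (∫ x in τ..1, deriv e x ^ 2))) := by ring
          _ ≤ _ := by gcongr
      have t4 : |∫ x in (0 : ℝ)..1, η x * (b x * deriv e x)| ≤
          Q * H ^ k * (B * epsNorm ε e) + Q * H ^ k * (B * (Real.sqrt I * epsNorm ε e)) := by
        rw [← intervalIntegral.integral_add_adjacent_intervals
          ((hηL.bm.mul hbe).ii le_rfl hτ0.le hτ1.le) ((hηL.bm.mul hbe).ii hτ0.le hτ1.le le_rfl)]
        exact (abs_add_le _ _).trans (add_le_add t1 t3)
      have t5 : ε * (semi1 η * semi1 e) ≤ 2 * Q * H ^ k * epsNorm ε e := by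
        calc _ = (Real.sqrt ε * semi1 η) * (Real.sqrt ε * semi1 e) := by
              rw [mul_mul_mul_comm, hss]
          _ ≤ _ := mul_le_mul hn1 e1 (mul_nonneg hs0 (semi1_nonneg _)) (by positivity)
      have t6 : 2 * B * (norm0 η * norm0 e) ≤ 2 * B * (2 * Q * H ^ k * epsNorm ε e) :=
        mul_le_mul_of_nonneg_left (mul_le_mul hn0 e0 (norm0_nonneg _) (by positivity))
          (by linarith)
      have t7 : 0 ≤ R * H ^ k * |e 0| := by positivity
      calc _ ≤ R * H ^ k * epsNorm ε e := by
            rw [hR]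
            linarith
        _ ≤ _ := by linarith)
  calc _ ≤ _ := main
    _ ≤ 4 * Q * H ^ k + G * (R * H ^ k) := by gcongr
    _ = _ := by ring

/-- For `k = 2` one has `τ/ε = ε^(-1/2)`, so the second alternative is the condition itself; the
first implies it because the exponential is at most `1`. -/
lemma layerSmall_two_iff (hε : 0 < ε) (μ : ℝ) :
    LayerSmall 2 ε H μ ↔
      (ε ≤ μ * H ^ 3 ∨ ε * Real.exp (-(1 / Real.sqrt ε)) ≤ μ * H ^ 3) := by
  have e1 : transition 2 ε / ε = 1 / Real.sqrt ε := by
    have : transition 2 ε = Real.sqrt ε := by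
      rw [transition, Real.sqrt_eq_rpow]
      norm_num
    rw [this, Real.sqrt_div_self']
  unfold LayerSmall
  rw [e1]
  refine ⟨Or.inr, ?_⟩
  rintro (h | h)
  · refine le_trans (mul_le_of_le_one_right hε.le (Real.exp_le_one_iff.2 ?_)) h
    have := Real.sqrt_nonneg ε
    rw [neg_nonpos]
    positivity
  · exact h

end error

end WeakLayer

/-! ### Union of the two regimes -/

theorem mainTheorem3
    (k : ℕ) (hk : 2 ≤ k)
    (b c f : ℝ → ℝ)
    (hb : ContDiffOn ℝ ∞ b (Icc 0 1)) (hc : ContDiffOn ℝ ∞ c (Icc 0 1))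
    (hf : ContDiffOn ℝ ∞ f (Icc 0 1))
    (hb1 : ∀ x ∈ Icc (0 : ℝ) 1, 1 < b x)
    (ε₀ γ : ℝ) (hε₀ : 0 < ε₀) (hε₀' : ε₀ ≤ 1) (hγ : 0 < γ)
    (hell : ∀ ε ∈ Ioo (0 : ℝ) ε₀, WeakLayer.VElliptic ε b c γ)
    (α₁ μ : ℝ) :
    ∃ C : ℝ, 0 < C ∧
      ∀ ε ∈ Ioo (0 : ℝ) ε₀, ∀ u : ℝ → ℝ, WeakLayer.IsSolution ε b c f u →
      ∀ (α H : ℝ) (N₁ N₂ : ℕ), α ≤ α₁ → WeakLayer.IsMesh k ε α H N₁ N₂ →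
      ∀ uh : ℝ → ℝ, WeakLayer.IsFESolution k ε α H N₁ N₂ b c f uh →
        (WeakLayer.LayerSmall k ε H μ →
          WeakLayer.epsNorm ε (fun x => u x - uh x) ≤ C * H ^ k) ∧
        (k = 2 →
          (WeakLayer.LayerSmall k ε H μ ↔
            (ε ≤ μ * H ^ 3 ∨ ε * Real.exp (-(1 / Real.sqrt ε)) ≤ μ * H ^ 3))) := by
  obtain ⟨C, hC, hsmall⟩ := WeakLayer.exists_error_small hk hb hc hf hb1 hγ α₁
  obtain ⟨D, hD, hlarge⟩ := WeakLayer.exists_error_large hk hb hc hf hb1 hγ α₁ μ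
  refine ⟨C + D, by positivity, fun ε hε u hu α H N₁ N₂ hα hM uh huh => ⟨fun hlay => ?_, ?_⟩⟩
  · have hε1 : ε < 1 := hε.2.trans_le hε₀'
    have hP : 0 < H ^ k := pow_pos hM.H_pos k
    rw [add_mul]
    -- The smallness of the layer at `τ` enters only in the second case.
    rcases le_total ε (H ^ k) with h | h
    · have := hsmall ε hε.1 hε1 (hell ε hε) u hu α H N₁ N₂ hα hM h uh huh
      linarith [mul_pos hD hP]
    · have := hlarge ε hε.1 hε1 (hell ε hε) u hu α H N₁ N₂ hα hM h hlay uh huh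
      linarith [mul_pos hC hP]
  · rintro rfl
    exact WeakLayer.layerSmall_two_iff hε.1 μ
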